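/- **Theorem (Sobolev-type representation, non-permutable case).** Let $1<\alpha\le 2$, $0<\beta\le 1$, $T>0$, $\mathbb J=[0,T]$; let $X,Y$ be Banach spaces, $g\in C(\mathbb J,Y)$, $\eta,\tilde\eta\in Y$, and let $E:D(E)\subset X\to Y$, $A_0:D(A_0)\subset X\to Y$, $B_0:D(B_0)\subset X\to Y$ be linear operators such that - (H1) $A_0$ is closed; - (H2) $B_0$ is bounded, i.e. $\|B_0v\|\le C\|v\|$ on $D(B_0)$, and $D(E)\subset D(B_0)$; - (H3) $D(E)\subset D(A_0)$ and $E:D(E)\to Y$ is bijective; - (H4) $E^{-1}:Y\to X$ is compact. Then $E^{-1}$, $A:=A_0E^{-1}$ and $B:=B_0E^{-1}$ are bounded. $A$ and $B$ are not assumed to commute. Put $$Q_{k,0}=A^k,\qquad Q_{k,m}=\sum_{l=0}^{k}A^{k-l}BQ_{l,m-1}\ (m\ge 1),\qquad \mathscr E_{c}(t)=\sum_{k=0}^\infty\sum_{m=0}^\infty Q_{k,m}\frac{t^{k(\alpha-\beta)+m\alpha}}{\Gamma(k(\alpha-\beta)+m\alpha+c)} .$$ For $c>0$ and $t\ge0$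 this double series converges absolutely in operator norm. Consider the Cauchy problem $$D^\alpha(Ey)(t)-A_0D^\beta y(t)=B_0y(t)+g(t)\quad(0<t\le T),\qquad (Ey)(0)=\eta,\quad (Ey)'(0)=\tilde\eta, \tag{1}$$ with Caputo derivatives $D^\alpha,D^\beta$ of lower limit $0$, and the function $$\begin{aligned}y_*(t)&=\bigl(E^{-1}+t^{\alpha}E^{-1}\mathscr E_{\alpha+1}(t)B\bigr)\eta+tE^{-1}\mathscr E_{2}(t)\tilde\eta+\int_0^t(t-s)^{\alpha-1}E^{-1}\mathscr E_{\alpha}(t-s)g(s)\,ds\\ &=\Bigl(E^{-1}+\sum_{k,m}E^{-1}Q_{k,m}B\tfrac{t^{k(\alpha-\beta)+m\alpha+\alpha}}{\Gamma(k(\alpha-\beta)+m\alpha+\alpha+1)}\Bigr)\eta+\sum_{k,m}E^{-1}Q_{k,m}\tfrac{t^{k(\alpha-\beta)+m\alpha+1}}{\Gamma(k(\alpha-\beta)+m\alpha+2)}\tilde\eta\\ &\quad+\int_0^t\sum_{k,m}E^{-1}Q_{k,m}\tfrac{(t-s)^{k(\alpha-\beta)+m\alpha+\alpha-1}}{\Gamma(k(\alpha-\beta)+m\alpha+\alpha)}g(s)\,ds,\qquad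 t\in\mathbb J,\end{aligned}$$ in which the first integral exists as a Bochner integral and the two expressions agree on $\mathbb J$. Write $I^\nu$ for the fractional integral of order $\nu$ with lower limit $0$ ($I^0=\mathrm{id}$). 1. $y_*$ is the unique mild solution of (1) on $\mathbb J$, that is, the unique $y:\mathbb J\to D(E)$ with $Ey\in C(\mathbb J,Y)$ such that, for all $t\in\mathbb J$, $I^{\alpha-\beta}(y-y(0))(t)\in D(A_0)$ and $$Ey(t)=\eta+t\tilde\eta+A_0I^{\alpha-\beta}(y-y(0))(t)+I^{\alpha}(B_0y+g)(t).$$ 2. $y_*$ is the unique solution of (1) in the following sense: $y:\mathbb J\to D(E)$, $Ey\in C^1(\mathbb J,Y)$, $y\in C(\mathbb J,X)$; the Caputo derivatives, taken as $D^\nu f=\frac{d^n}{dt^n}I^{n-\nu}\bigl(f-\sum_{k<n}\frac{t^k}{k!}f^{(k)}(0)\bigr)$ for $n-1<\nu\le n$, exist with $I^{2-\alpha}\bigl(Ey-(Ey)(0)-t(Ey)'(0)\bigr)\in C^2(\mathbb J,Y)$ and $I^{1-\beta}(y-y(0))\in C^1(\mathbb J,X)$; $D^\beta y(t)\in D(A_0)$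 for $0<t\le T$; and (1) holds. 3. In particular, every solution $y\in C^2(\mathbb J,X)$ of (1) with values in $D(E)$, with $Ey\in C^2(\mathbb J,Y)$ and $D^\beta y(t)\in D(A_0)$ for $0<t\le T$, where $D^\nu f=I^{n-\nu}f^{(n)}$, is equal to $y_*$ on $\mathbb J$. -/

import Mathlib

open Set MeasureTheory

noncomputable section

namespace SobolevFrac

section Fractional

variable {F : Type*} [NormedAddCommGroup F] [NormedSpace ℝ F]

/-- The fractional integral `I^ν` with lower limit `0` (Bochner integral);
`I^0` is the identity, by the usual convention. -/
def fracInt (ν : ℝ) (f : ℝ → F) (t : ℝ) : F :=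
  if ν = 0 then f t else (Real.Gamma ν)⁻¹ • ∫ s in (0 : ℝ)..t, (t - s) ^ (ν - 1) • f s

/-- The Caputo derivative of order `n - 1 < ν ≤ n` of a function of class `C^n` on `[0, T]`,
as the fractional integral of order `n - ν` of the `n`-th derivative. -/
def caputoClassical (T ν : ℝ) (f : ℝ → F) (t : ℝ) : F :=
  fracInt ((⌈ν⌉₊ : ℝ) - ν) (iteratedDerivWithin ⌈ν⌉₊ f (Icc 0 T)) t

/-- The Taylor polynomial of `f` at `0` with `n` terms (derivatives taken within `[0, T]`). -/
def taylorZero (T : ℝ) (n : ℕ) (f : ℝ → F) (t : ℝ) : F :=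
  ∑ k ∈ Finset.range n, (t ^ k / (k.factorial : ℝ)) • iteratedDerivWithin k f (Icc 0 T) 0

/-- The fractional integral of order `n - ν` of `f` minus its Taylor polynomial at `0`; its `n`-th
derivative is the Caputo derivative of `f`. -/
def caputoPrimitive (T ν : ℝ) (f : ℝ → F) : ℝ → F :=
  fracInt ((⌈ν⌉₊ : ℝ) - ν) (fun s => f s - taylorZero T ⌈ν⌉₊ f s)

/-- The Caputo derivative of order `n - 1 < ν ≤ n`, as the Riemann-Liouville derivative of `f`
minus its Taylor polynomial at `0`. -/
def caputo (T ν : ℝ) (f : ℝ → F) (t : ℝ) : F :=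
  iteratedDerivWithin ⌈ν⌉₊ (caputoPrimitive T ν f) (Icc 0 T) t

/-- The derivatives in `caputo T ν f` exist and are continuous on `[0, T]`. -/
def CaputoDifferentiable (T ν : ℝ) (f : ℝ → F) : Prop :=
  ContDiffOn ℝ ((⌈ν⌉₊ - 1 : ℕ) : WithTop ℕ∞) f (Icc 0 T) ∧
    ContDiffOn ℝ ((⌈ν⌉₊ : ℕ) : WithTop ℕ∞) (caputoPrimitive T ν f) (Icc 0 T)

end Fractional

section MittagLeffler

variable {Y : Type*} [NormedAddCommGroup Y] [NormedSpace ℝ Y]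

/-- The operators `Q_{k,m}^{A,B}`. -/
def Q (A B : Y →L[ℝ] Y) : ℕ → ℕ → (Y →L[ℝ] Y)
  | k, 0 => A ^ k
  | k, m + 1 => ∑ l ∈ Finset.range (k + 1), A ^ (k - l) * B * Q A B l m

theorem Q_zero_left (A B : Y →L[ℝ] Y) (m : ℕ) : Q A B 0 m = B ^ m := by
  induction m with
  | zero => simp [Q]
  | succ m ih => simp [Q, ih, pow_succ']

/-- The term of index `(k, m)` of the Mittag-Leffler type series. -/
def mlTerm (a b c : ℝ) (A B : Y →L[ℝ] Y) (t : ℝ) (k m : ℕ) : Y →L[ℝ] Y :=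
  (t ^ ((k : ℝ) * a + (m : ℝ) * b) / Real.Gamma ((k : ℝ) * a + (m : ℝ) * b + c)) • Q A B k m

/-- The Mittag-Leffler type function `ℰ_{a,b,c}^{A,B}(t)`. -/
def ml (a b c : ℝ) (A B : Y →L[ℝ] Y) (t : ℝ) : Y →L[ℝ] Y :=
  ∑' k : ℕ, ∑' m : ℕ, mlTerm a b c A B t k m

end MittagLeffler

section Operators

variable {X Y : Type*} [NormedAddCommGroup X] [NormedSpace ℝ X]
  [NormedAddCommGroup Y] [NormedSpace ℝ Y]

/-- The value `S v`, for `v` in the domain of `S` (and `0` elsewhere). -/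
def app (S : X →ₗ.[ℝ] Y) (v : X) : Y :=
  open Classical in if h : v ∈ S.domain then S ⟨v, h⟩ else 0

theorem app_of_mem (S : X →ₗ.[ℝ] Y) {v : X} (h : v ∈ S.domain) : app S v = S ⟨v, h⟩ :=
  dif_pos h

/-- The bijection `E : D(E) → Y` as a linear equivalence. -/
def domEquiv (E : X →ₗ.[ℝ] Y) (hE : Function.Bijective E) : E.domain ≃ₗ[ℝ] Y :=
  LinearEquiv.ofBijective E.toFun hE

/-- The inverse `E⁻¹ : Y → D(E) ⊆ X`. -/
def invE (E : X →ₗ.[ℝ] Y) (hE : Function.Bijective E) : Y →ₗ[ℝ] X :=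
  E.domain.subtype ∘ₗ (domEquiv E hE).symm.toLinearMap

/-- The product `S E⁻¹ : Y → Y`, where `D(E) ⊆ D(S)`. -/
def compInv (S E : X →ₗ.[ℝ] Y) (hE : Function.Bijective E) (h : E.domain ≤ S.domain) :
    Y →ₗ[ℝ] Y :=
  S.toFun ∘ₗ Submodule.inclusion h ∘ₗ (domEquiv E hE).symm.toLinearMap

/-- `y` is a mild solution on `[0, T]` of the Cauchy problem
`D^α (E y) - A₀ D^β y = B₀ y + g`, `E y(0) = η`, `(E y)'(0) = η'`: it is continuous with values
in `D(E)` (normed by `‖E ·‖`) and satisfies the integrated equation. -/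
structure IsMildSolution (α β T : ℝ) (E A₀ B₀ : X →ₗ.[ℝ] Y) (η η' : Y) (g : ℝ → Y)
    (y : ℝ → X) : Prop where
  mem_domain : ∀ t ∈ Icc 0 T, y t ∈ E.domain
  continuousOn : ContinuousOn (fun t => app E (y t)) (Icc 0 T)
  integral_mem : ∀ t ∈ Icc 0 T, fracInt (α - β) (fun s => y s - y 0) t ∈ A₀.domain
  equation : ∀ t ∈ Icc 0 T,
    app E (y t) = η + t • η' + app A₀ (fracInt (α - β) (fun s => y s - y 0) t)
      + fracInt α (fun s => app B₀ (y s) + g s) t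

/-- `y` solves the same Cauchy problem with (continuous) Caputo derivatives. -/
structure IsCaputoSolution (α β T : ℝ) (E A₀ B₀ : X →ₗ.[ℝ] Y) (η η' : Y) (g : ℝ → Y)
    (y : ℝ → X) : Prop where
  mem_domain : ∀ t ∈ Icc 0 T, y t ∈ E.domain
  differentiable_E : CaputoDifferentiable T α (fun t => app E (y t))
  differentiable : CaputoDifferentiable T β y
  initial_value : app E (y 0) = η
  initial_deriv : derivWithin (fun t => app E (y t)) (Icc 0 T) 0 = η'
  deriv_mem : ∀ t ∈ Ioc 0 T, caputo T β y t ∈ A₀.domain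
  equation : ∀ t ∈ Ioc 0 T,
    caputo T α (fun r => app E (y r)) t - app A₀ (caputo T β y t) = app B₀ (y t) + g t

/-- `y` solves the same Cauchy problem, and `y` and `E y` are of class `C²` on `[0, T]`. -/
structure IsC2Solution (α β T : ℝ) (E A₀ B₀ : X →ₗ.[ℝ] Y) (η η' : Y) (g : ℝ → Y)
    (y : ℝ → X) : Prop where
  mem_domain : ∀ t ∈ Icc 0 T, y t ∈ E.domain
  contDiffOn : ContDiffOn ℝ 2 y (Icc 0 T)
  contDiffOn_E : ContDiffOn ℝ 2 (fun t => app E (y t)) (Icc 0 T)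
  initial_value : app E (y 0) = η
  initial_deriv : derivWithin (fun t => app E (y t)) (Icc 0 T) 0 = η'
  deriv_mem : ∀ t ∈ Ioc 0 T, caputoClassical T β y t ∈ A₀.domain
  equation : ∀ t ∈ Ioc 0 T,
    caputoClassical T α (fun r => app E (y r)) t - app A₀ (caputoClassical T β y t)
      = app B₀ (y t) + g t

/-- The representation formula through the Mittag-Leffler type function, with `R = E⁻¹`. -/
def formula (α β : ℝ) (R : Y →L[ℝ] X) (A B : Y →L[ℝ] Y) (η η' : Y) (g : ℝ → Y) (t : ℝ) : X :=
  (R + t ^ α • (R ∘L ml (α - β) α (α + 1) A B t ∘L B)) η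
    + (t • (R ∘L ml (α - β) α 2 A B t)) η'
    + ∫ s in (0 : ℝ)..t, ((t - s) ^ (α - 1) • (R ∘L ml (α - β) α α A B (t - s))) (g s)

/-- The representation formula written out as double series, with `R = E⁻¹`. -/
def seriesFormula (α β : ℝ) (R : Y →L[ℝ] X) (A B : Y →L[ℝ] Y) (η η' : Y) (g : ℝ → Y)
    (t : ℝ) : X :=
  (R + ∑' k : ℕ, ∑' m : ℕ,
      (t ^ ((k : ℝ) * (α - β) + (m : ℝ) * α + α)
        / Real.Gamma ((k : ℝ) * (α - β) + (m : ℝ) * α + α + 1)) • (R ∘L Q A B k m ∘L B)) η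
    + (∑' k : ℕ, ∑' m : ℕ,
      (t ^ ((k : ℝ) * (α - β) + (m : ℝ) * α + 1)
        / Real.Gamma ((k : ℝ) * (α - β) + (m : ℝ) * α + 2)) • (R ∘L Q A B k m)) η'
    + ∫ s in (0 : ℝ)..t, (∑' k : ℕ, ∑' m : ℕ,
      ((t - s) ^ ((k : ℝ) * (α - β) + (m : ℝ) * α + α - 1)
        / Real.Gamma ((k : ℝ) * (α - β) + (m : ℝ) * α + α)) • (R ∘L Q A B k m)) (g s)

end Operators

end SobolevFrac

end

namespace SobolevFrac

open Filter Topology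

/-! Put u = E y, so that y = E⁻¹ u. Since E⁻¹ maps into D(E) ⊆ D(A₀), the unbounded operators enter
only through the bounded A and B, and the mild equation becomes a Volterra equation in C([0, T], Y):
u - η = f + V (u - η), where V = A I^a + B I^α, a = α - β, and f = tη' + I^α(Bη) + I^α g.
(`isMildSolution_iff_exists`, `integralEquation_iff`)

Fractional integrals commute with constant bounded operators and satisfy I^μ I^ν = I^(μ+ν). So
although A and B need not commute, the part of the Neumann series of V with k factors A I^a and m
factors B I^α is Q_{k,m} I^(ka+mα), where Q_{k,m} is the sum of all words in k letters A and m
letters B. There are at most 2^(k+m) words, and the factor 1/Γ beats every geometric growth, so the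
series converges absolutely. Splitting words at their first or last letter gives two recursions for
Q, hence S = 1 + VS and S = 1 + SV for the sum S: existence and uniqueness (`eq_add_volterra_iff`).
Evaluating S on powers of t and on I^α g produces the Mittag-Leffler functions (`formula_eq`).

Caputo solutions coincide with mild ones. From Caputo to mild, the equation is integrated inside the
closed graph of A₀ and I^(α-1) is applied. Conversely, S commutes with I^1, so u - η = I^1 v with v
continuous, and all required derivatives can be read off. A C² solution is a Caputo solution because
fractional integration commutes with taking primitives. -/

theorem rpow_le_mul_Gamma {r y : ℝ} (hr : 0 < r) (hy : 0 < y) :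
    r ^ y ≤ Real.exp (Real.exp 1 * r + 1) * Real.Gamma y := by
  -- On (R, R+1] the integrand of Γ(y+1) is at least R^y e^(-(R+1)). Taking R = e·r instead of r
  -- leaves a spare factor e^y, which absorbs the y in Γ(y+1) = yΓ(y).
  have hR : 0 < Real.exp 1 * r := by positivity
  set R := Real.exp 1 * r with hRdef
  have key : R ^ y * Real.exp (-(R + 1)) ≤ Real.Gamma (y + 1) := by
    rw [Real.Gamma_eq_integral (by linarith)]
    have hint : IntegrableOn (fun x : ℝ => Real.exp (-x) * x ^ (y + 1 - 1)) (Ioi 0) :=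
      Real.GammaIntegral_convergent (by linarith)
    have h1 : ∫ x in Ioc R (R + 1), R ^ y * Real.exp (-(R + 1)) = R ^ y * Real.exp (-(R + 1)) := by
      simp
    rw [← h1]
    refine (setIntegral_mono_on (integrableOn_const (by simp))
      (hint.mono_set fun x hx => hR.trans hx.1) measurableSet_Ioc fun x hx => ?_).trans
      (setIntegral_mono_set hint ?_ (Eventually.of_forall fun x hx => hR.trans hx.1))
    · rw [add_sub_cancel_right, mul_comm]
      exact mul_le_mul (Real.exp_le_exp.2 (by linarith [hx.2]))
        (Real.rpow_le_rpow hR.le hx.1.le hy.le) (by positivity) (by positivity)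
    · filter_upwards [ae_restrict_mem measurableSet_Ioi] with x hx
      have : (0 : ℝ) < x := hx
      simp only [Pi.zero_apply]
      positivity
  rw [Real.Gamma_add_one hy.ne', hRdef, Real.mul_rpow (Real.exp_pos 1).le hr.le, ← hRdef,
    Real.exp_neg, ← div_eq_mul_inv, div_le_iff₀ (Real.exp_pos _), ← Real.exp_mul, one_mul] at key
  have h2 : y ≤ Real.exp y := by linarith [Real.add_one_le_exp y]
  have h3 : y * Real.Gamma y * Real.exp (R + 1) ≤
      Real.exp y * (Real.exp (R + 1) * Real.Gamma y) := by
    have := mul_le_mul_of_nonneg_right h2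
      (mul_pos (Real.exp_pos (R + 1)) (Real.Gamma_pos_of_pos hy)).le
    linarith
  exact le_of_mul_le_mul_left (key.trans h3) (Real.exp_pos y)

/-! ### Words in A and B, and convergence of the Mittag-Leffler series -/

section MittagLeffler

variable {Y : Type*} [NormedAddCommGroup Y] [NormedSpace ℝ Y] (A B : Y →L[ℝ] Y)

theorem Q_zero_right (k : ℕ) : Q A B k 0 = A ^ k := by simp [Q]

theorem Q_succ_zero (k : ℕ) : Q A B (k + 1) 0 = A * Q A B k 0 := by
  simp [Q_zero_right, pow_succ']

theorem Q_succ_zero' (k : ℕ) : Q A B (k + 1) 0 = Q A B k 0 * A := by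
  simp [Q_zero_right, pow_succ]

theorem Q_zero_succ (m : ℕ) : Q A B 0 (m + 1) = B * Q A B 0 m := by
  simp [Q_zero_left, pow_succ']

theorem Q_zero_succ' (m : ℕ) : Q A B 0 (m + 1) = Q A B 0 m * B := by
  simp [Q_zero_left, pow_succ]

/-- Words sorted by their first letter. In the definition of `Q`, the index l records how many
letters A remain after the first B. -/
theorem Q_succ_succ (k m : ℕ) :
    Q A B (k + 1) (m + 1) = A * Q A B k (m + 1) + B * Q A B (k + 1) m := by
  rw [Q, Finset.sum_range_succ, Q, Finset.mul_sum]
  congr 1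
  · refine Finset.sum_congr rfl fun l hl => ?_
    rw [Nat.succ_sub (Nat.lt_succ_iff.1 (Finset.mem_range.1 hl)), pow_succ']
    simp only [mul_assoc]
  · simp

/-- Words sorted by their last letter. By double induction: split off the first letter, apply the
claim to the shorter words, and regroup by the last letter. The boundary cases need the one-letter
words separately. -/
theorem Q_succ_succ' (k m : ℕ) :
    Q A B (k + 1) (m + 1) = Q A B k (m + 1) * A + Q A B (k + 1) m * B := by
  induction k generalizing m with
  | zero =>
    induction m with
    | zero => simp [Q_succ_succ, Q_zero_left, Q_zero_right, add_comm]
    | succ m ih =>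
      calc Q A B (0 + 1) (m + 1 + 1)
          = A * (Q A B 0 (m + 1) * B) + B * (Q A B 0 (m + 1) * A + Q A B (0 + 1) m * B) := by
            rw [← ih, ← Q_zero_succ', Q_succ_succ]
        _ = B * Q A B 0 (m + 1) * A + (A * Q A B 0 (m + 1) + B * Q A B (0 + 1) m) * B := by
            noncomm_ring
        _ = _ := by rw [← Q_succ_succ, ← Q_zero_succ]
  | succ k ihk =>
    induction m with
    | zero =>
      calc Q A B (k + 1 + 1) (0 + 1)
          = A * (Q A B k (0 + 1) * A + Q A B (k + 1) 0 * B) + B * (Q A B (k + 1) 0 * A) := by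
            rw [← ihk, ← Q_succ_zero', Q_succ_succ]
        _ = (A * Q A B k (0 + 1) + B * Q A B (k + 1) 0) * A + A * Q A B (k + 1) 0 * B := by
            noncomm_ring
        _ = _ := by rw [← Q_succ_succ, ← Q_succ_zero]
    | succ m ih =>
      calc Q A B (k + 1 + 1) (m + 1 + 1)
          = A * (Q A B k (m + 1 + 1) * A + Q A B (k + 1) (m + 1) * B) +
              B * (Q A B (k + 1) (m + 1) * A + Q A B (k + 1 + 1) m * B) := by
            rw [← ihk, ← ih, Q_succ_succ]
        _ = (A * Q A B k (m + 1 + 1) + B * Q A B (k + 1) (m + 1)) * A +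
              (A * Q A B (k + 1) (m + 1) + B * Q A B (k + 1 + 1) m) * B := by
            noncomm_ring
        _ = _ := by rw [← Q_succ_succ, ← Q_succ_succ]

/-- The 2^(k+m) bounds the number of words. In the recursion each of the two summands is at most
half of the right-hand side. -/
theorem norm_Q_le (k m : ℕ) : ‖Q A B k m‖ ≤ (2 * ‖A‖) ^ k * (2 * ‖B‖) ^ m := by
  induction k generalizing m with
  | zero =>
    induction m with
    | zero =>
      simp only [Q_zero_left, pow_zero, mul_one]
      exact ContinuousLinearMap.norm_id_le
    | succ m ih =>
      rw [Q_zero_succ]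
      refine (norm_mul_le _ _).trans ?_
      have := mul_le_mul_of_nonneg_left ih (norm_nonneg B)
      have h : 0 ≤ ‖B‖ * ((2 * ‖A‖) ^ 0 * (2 * ‖B‖) ^ m) := by positivity
      rw [pow_succ]
      linarith
  | succ k ihk =>
    induction m with
    | zero =>
      rw [Q_succ_zero]
      refine (norm_mul_le _ _).trans ?_
      have := mul_le_mul_of_nonneg_left (ihk 0) (norm_nonneg A)
      have h : 0 ≤ ‖A‖ * ((2 * ‖A‖) ^ k * (2 * ‖B‖) ^ 0) := by positivity
      rw [pow_succ]
      linarith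
    | succ m ih =>
      rw [Q_succ_succ]
      refine (norm_add_le_of_le (norm_mul_le _ _) (norm_mul_le _ _)).trans ?_
      have h1 := mul_le_mul_of_nonneg_left (ihk (m + 1)) (norm_nonneg A)
      have h2 := mul_le_mul_of_nonneg_left ih (norm_nonneg B)
      refine (add_le_add h1 h2).trans (le_of_eq ?_)
      ring

theorem index_nonneg {a b : ℝ} (ha : 0 ≤ a) (hb : 0 ≤ b) (k m : ℕ) :
    0 ≤ (k : ℝ) * a + (m : ℝ) * b := by positivity

/-- The series of norms defining the Mittag-Leffler type function converges. -/
theorem summable_norm_Q_mul {a b c t : ℝ} (ha : 0 < a) (hb : 0 < b) (hc : 0 < c) (ht : 0 ≤ t) :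
    Summable fun p : ℕ × ℕ => t ^ ((p.1 : ℝ) * a + (p.2 : ℝ) * b) /
      Real.Gamma ((p.1 : ℝ) * a + (p.2 : ℝ) * b + c) * ‖Q A B p.1 p.2‖ := by
  have hlim : ∀ {d : ℝ}, 0 < d → ∀ M : ℝ, ∀ᶠ r in atTop, M * (t / r) ^ d < 1 := by
    intro d hd M
    have h1 : Tendsto (fun r : ℝ => t / r) atTop (𝓝 0) := tendsto_const_nhds.div_atTop tendsto_id
    have h2 := (h1.rpow_const (Or.inr hd.le)).const_mul M
    rw [Real.zero_rpow hd.ne', mul_zero] at h2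
    exact h2.eventually (gt_mem_nhds one_pos)
  -- Writing t^n = (t/r)^n r^n, the factor r^n / Γ(n+c) is bounded for every r; a large r makes the
  -- remaining factors terms of two convergent geometric series.
  obtain ⟨r, hrA, hrB, hr⟩ := ((hlim ha (2 * ‖A‖)).and
    ((hlim hb (2 * ‖B‖)).and (eventually_gt_atTop 0))).exists
  have htr : 0 ≤ t / r := by positivity
  set p := 2 * ‖A‖ * (t / r) ^ a with hp
  set q := 2 * ‖B‖ * (t / r) ^ b with hq
  have hp0 : 0 ≤ p := by positivity
  have hq0 : 0 ≤ q := by positivity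
  have hgeo : Summable fun x : ℕ × ℕ => p ^ x.1 * q ^ x.2 :=
    (summable_geometric_of_lt_one hp0 hrA).mul_of_nonneg (summable_geometric_of_lt_one hq0 hrB)
      (fun _ => pow_nonneg hp0 _) (fun _ => pow_nonneg hq0 _)
  refine Summable.of_nonneg_of_le (fun x => ?_) (fun x => ?_)
    (hgeo.mul_left ((r ^ c)⁻¹ * Real.exp (Real.exp 1 * r + 1)))
  · have := index_nonneg ha.le hb.le x.1 x.2
    have := Real.Gamma_pos_of_pos (add_pos_of_nonneg_of_pos this hc)
    positivity
  · obtain ⟨k, m⟩ := x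
    have hn := index_nonneg ha.le hb.le k m
    have hG := Real.Gamma_pos_of_pos (add_pos_of_nonneg_of_pos hn hc)
    have h1 := rpow_le_mul_Gamma hr (add_pos_of_nonneg_of_pos hn hc)
    dsimp only
    set n := (k : ℝ) * a + (m : ℝ) * b with hndef
    have h2 : t ^ n = (t / r) ^ n * r ^ n := by
      rw [← Real.mul_rpow htr hr.le, div_mul_cancel₀ _ hr.ne']
    have h3 : (t / r) ^ n = ((t / r) ^ a) ^ k * ((t / r) ^ b) ^ m := by
      rw [hndef, Real.rpow_add_of_nonneg htr (by positivity) (by positivity), mul_comm (k : ℝ),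
        mul_comm (m : ℝ), Real.rpow_mul_natCast htr, Real.rpow_mul_natCast htr]
    have h4 : r ^ n / Real.Gamma (n + c) ≤ (r ^ c)⁻¹ * Real.exp (Real.exp 1 * r + 1) := by
      rw [div_le_iff₀ hG, mul_assoc, ← div_eq_inv_mul, le_div_iff₀ (by positivity),
        ← Real.rpow_add hr]
      exact h1
    calc t ^ n / Real.Gamma (n + c) * ‖Q A B k m‖
        = (r ^ n / Real.Gamma (n + c)) * ((t / r) ^ n * ‖Q A B k m‖) := by rw [h2]; ring
      _ ≤ ((r ^ c)⁻¹ * Real.exp (Real.exp 1 * r + 1)) *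
          ((t / r) ^ n * ((2 * ‖A‖) ^ k * (2 * ‖B‖) ^ m)) := by
          gcongr
          exact norm_Q_le A B k m
      _ = _ := by rw [h3, hp, hq, mul_pow, mul_pow]; ring

theorem norm_mlTerm {a b c t : ℝ} (ha : 0 < a) (hb : 0 < b) (hc : 0 < c) (ht : 0 ≤ t) (k m : ℕ) :
    ‖mlTerm a b c A B t k m‖ = t ^ ((k : ℝ) * a + (m : ℝ) * b) /
      Real.Gamma ((k : ℝ) * a + (m : ℝ) * b + c) * ‖Q A B k m‖ := by
  have := Real.Gamma_pos_of_pos (add_pos_of_nonneg_of_pos (index_nonneg ha.le hb.le k m) hc)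
  rw [mlTerm, norm_smul, Real.norm_of_nonneg (by positivity)]

theorem summable_norm_mlTerm {a b c t : ℝ} (ha : 0 < a) (hb : 0 < b) (hc : 0 < c) (ht : 0 ≤ t) :
    Summable fun p : ℕ × ℕ => ‖mlTerm a b c A B t p.1 p.2‖ := by
  simpa only [norm_mlTerm A B ha hb hc ht] using summable_norm_Q_mul A B ha hb hc ht

theorem hasSum_ml [CompleteSpace Y] {a b c t : ℝ} (ha : 0 < a) (hb : 0 < b) (hc : 0 < c)
    (ht : 0 ≤ t) : HasSum (fun p : ℕ × ℕ => mlTerm a b c A B t p.1 p.2) (ml a b c A B t) := by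
  have h := (summable_norm_mlTerm A B ha hb hc ht).of_norm
  rw [ml, ← h.tsum_prod]
  exact h.hasSum

end MittagLeffler

/-- A family of index `ℕ × ℕ` satisfying a two-term linear recursion sums up to a solution of the
corresponding linear equation. -/
theorem tsum_eq_of_two_term_recursion {V : Type*} [NormedAddCommGroup V] [NormedSpace ℝ V]
    (φ ψ : V →L[ℝ] V) (W : ℕ → ℕ → V) (hW : Summable fun p : ℕ × ℕ => W p.1 p.2)
    (h₁ : ∀ k, W (k + 1) 0 = φ (W k 0)) (h₂ : ∀ m, W 0 (m + 1) = ψ (W 0 m))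
    (h₃ : ∀ k m, W (k + 1) (m + 1) = φ (W k (m + 1)) + ψ (W (k + 1) m)) :
    ∑' p : ℕ × ℕ, W p.1 p.2 =
      W 0 0 + φ (∑' p : ℕ × ℕ, W p.1 p.2) + ψ (∑' p : ℕ × ℕ, W p.1 p.2) := by
  classical
  have hs := hW.hasSum
  -- F and G are the images of the family under φ and ψ, shifted by one in the first or second index
  -- and extended by zero. With the mass W 0 0 at the origin they add up to W.
  let F : ℕ × ℕ → V := fun p => if p.1 = 0 then 0 else φ (W (p.1 - 1) p.2)
  let G : ℕ × ℕ → V := fun p => if p.2 = 0 then 0 else ψ (W p.1 (p.2 - 1))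
  have hF : HasSum F (φ (∑' p : ℕ × ℕ, W p.1 p.2)) := by
    have hi : Function.Injective fun p : ℕ × ℕ => (p.1 + 1, p.2) := fun p q h => by
      simpa [Prod.ext_iff] using h
    rw [← hi.hasSum_iff]
    · exact φ.hasSum hs
    · rintro ⟨k, m⟩ hp
      cases k with
      | zero => rfl
      | succ k => exact absurd ⟨(k, m), rfl⟩ hp
  have hG : HasSum G (ψ (∑' p : ℕ × ℕ, W p.1 p.2)) := by
    have hi : Function.Injective fun p : ℕ × ℕ => (p.1, p.2 + 1) := fun p q h => by
      simpa [Prod.ext_iff] using h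
    rw [← hi.hasSum_iff]
    · exact ψ.hasSum hs
    · rintro ⟨k, m⟩ hp
      cases m with
      | zero => rfl
      | succ m => exact absurd ⟨(k, m), rfl⟩ hp
  have hδ := hasSum_ite_eq ((0, 0) : ℕ × ℕ) (W 0 0)
  refine hs.unique ?_
  convert! (hδ.add hF).add hG using 1
  funext ⟨k, m⟩
  rcases k with _ | k <;> rcases m with _ | m <;> simp [F, G, h₁, h₂, h₃]

/-! ### Fractional integrals of functions -/

section FracInt

variable {F G : Type*} [NormedAddCommGroup F] [NormedSpace ℝ F]
  [NormedAddCommGroup G] [NormedSpace ℝ G]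

theorem fracInt_zero (f : ℝ → F) (t : ℝ) : fracInt 0 f t = f t := if_pos rfl

theorem fracInt_of_pos {ν : ℝ} (hν : 0 < ν) (f : ℝ → F) (t : ℝ) :
    fracInt ν f t = (Real.Gamma ν)⁻¹ • ∫ s in (0 : ℝ)..t, (t - s) ^ (ν - 1) • f s :=
  if_neg hν.ne'

theorem fracInt_congr {T ν t : ℝ} {f g : ℝ → F} (h : EqOn f g (Icc 0 T)) (ht : t ∈ Icc 0 T) :
    fracInt ν f t = fracInt ν g t := by
  unfold fracInt
  rw [h ht]
  congr 2
  refine intervalIntegral.integral_congr fun s hs => ?_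
  rw [uIcc_of_le ht.1] at hs
  simp only [h ⟨hs.1, hs.2.trans ht.2⟩]

theorem intervalIntegrable_kernel {ν : ℝ} (hν : 0 < ν) (t : ℝ) :
    IntervalIntegrable (fun s : ℝ => (t - s) ^ (ν - 1)) volume 0 t := by
  have h : IntervalIntegrable (fun s : ℝ => s ^ (ν - 1)) volume 0 t :=
    intervalIntegral.intervalIntegrable_rpow' (by linarith)
  simpa using (h.comp_sub_left t).symm

theorem integral_kernel {ν : ℝ} (hν : 0 < ν) (t : ℝ) :
    ∫ s in (0 : ℝ)..t, (t - s) ^ (ν - 1) = t ^ ν / ν := by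
  have h := intervalIntegral.integral_comp_sub_left (a := 0) (b := t)
    (fun s : ℝ => s ^ (ν - 1)) t
  rw [h, sub_self, sub_zero, integral_rpow (Or.inl (by linarith))]
  simp [Real.zero_rpow hν.ne']

theorem intervalIntegrable_kernel_smul {ν : ℝ} (hν : 0 < ν) (t : ℝ) {f : ℝ → F}
    (hf : Continuous f) :
    IntervalIntegrable (fun s : ℝ => (t - s) ^ (ν - 1) • f s) volume 0 t :=
  (intervalIntegrable_kernel hν t).smul_continuousOn hf.continuousOn

/-- The substitution s = tx makes the interval and the singular kernel independent of t, so that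
continuity in t follows by dominated convergence. -/
theorem fracInt_eq_integral_unit {ν : ℝ} (hν : 0 < ν) {t : ℝ} (ht : 0 ≤ t) (f : ℝ → F) :
    fracInt ν f t =
      (Real.Gamma ν)⁻¹ • t ^ ν • ∫ x in (0 : ℝ)..1, (1 - x) ^ (ν - 1) • f (t * x) := by
  rw [fracInt_of_pos hν]
  congr 1
  rcases ht.eq_or_lt with rfl | ht
  · simp [Real.zero_rpow hν.ne']
  have h := intervalIntegral.smul_integral_comp_mul_left (a := 0) (b := 1)
    (fun s : ℝ => (t - s) ^ (ν - 1) • f s) t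
  rw [mul_zero, mul_one] at h
  have h2 : t ^ ν = t * t ^ (ν - 1) := by
    rw [Real.rpow_sub_one ht.ne']; field_simp
  rw [← h, h2, mul_smul, ← intervalIntegral.integral_smul (t ^ (ν - 1))]
  congr 1
  refine intervalIntegral.integral_congr fun x hx => ?_
  rw [uIcc_of_le zero_le_one] at hx
  have h3 : t - t * x = t * (1 - x) := by ring
  simp only [h3, Real.mul_rpow ht.le (sub_nonneg.2 hx.2), mul_smul]

theorem norm_fracInt_le {ν : ℝ} (hν : 0 ≤ ν) {t : ℝ} (ht : 0 ≤ t) {f : ℝ → F} {M : ℝ}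
    (hM : ∀ s, ‖f s‖ ≤ M) : ‖fracInt ν f t‖ ≤ t ^ ν / Real.Gamma (ν + 1) * M := by
  rcases hν.eq_or_lt with rfl | hν
  · simpa [fracInt_zero] using hM t
  have hG := Real.Gamma_pos_of_pos hν
  rw [fracInt_of_pos hν, norm_smul, Real.norm_of_nonneg (by positivity),
    Real.Gamma_add_one hν.ne']
  have h1 : ‖∫ s in (0 : ℝ)..t, (t - s) ^ (ν - 1) • f s‖ ≤
      ∫ s in (0 : ℝ)..t, (t - s) ^ (ν - 1) * M := by
    refine intervalIntegral.norm_integral_le_of_norm_le ht ?_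
      ((intervalIntegrable_kernel hν t).mul_const M)
    refine Filter.Eventually.of_forall fun s hs => ?_
    have : 0 ≤ (t - s) ^ (ν - 1) := Real.rpow_nonneg (sub_nonneg.2 hs.2) _
    rw [norm_smul, Real.norm_of_nonneg this]
    exact mul_le_mul_of_nonneg_left (hM s) this
  rw [intervalIntegral.integral_mul_const, integral_kernel hν] at h1
  calc (Real.Gamma ν)⁻¹ * ‖∫ s in (0 : ℝ)..t, (t - s) ^ (ν - 1) • f s‖
      ≤ (Real.Gamma ν)⁻¹ * (t ^ ν / ν * M) := by gcongr
    _ = _ := by field_simp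

theorem fracInt_add {ν : ℝ} (hν : 0 ≤ ν) (t : ℝ) {f g : ℝ → F} (hf : Continuous f)
    (hg : Continuous g) :
    fracInt ν (fun s => f s + g s) t = fracInt ν f t + fracInt ν g t := by
  rcases hν.eq_or_lt with rfl | hν
  · simp [fracInt_zero]
  simp only [fracInt_of_pos hν, smul_add]
  rw [intervalIntegral.integral_add (intervalIntegrable_kernel_smul hν t hf)
    (intervalIntegrable_kernel_smul hν t hg), smul_add]

theorem fracInt_smul (ν : ℝ) (t c : ℝ) (f : ℝ → F) :
    fracInt ν (fun s => c • f s) t = c • fracInt ν f t := by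
  unfold fracInt
  split_ifs
  · rfl
  · simp only [smul_comm _ c]
    rw [intervalIntegral.integral_smul, smul_comm]

theorem fracInt_clm [CompleteSpace F] [CompleteSpace G] {ν : ℝ} (hν : 0 ≤ ν) (t : ℝ) {f : ℝ → F}
    (hf : Continuous f) (L : F →L[ℝ] G) :
    fracInt ν (fun s => L (f s)) t = L (fracInt ν f t) := by
  rcases hν.eq_or_lt with rfl | hν
  · simp [fracInt_zero]
  simp only [fracInt_of_pos hν, map_smul]
  rw [← L.intervalIntegral_comp_comm (intervalIntegrable_kernel_smul hν t hf)]
  simp only [map_smul]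

theorem continuousOn_fracInt {ν : ℝ} (hν : 0 ≤ ν) {f : ℝ → F} (hf : Continuous f) {M : ℝ}
    (hM : ∀ s, ‖f s‖ ≤ M) : ContinuousOn (fracInt ν f) (Ici 0) := by
  rcases hν.eq_or_lt with rfl | hν
  · exact hf.continuousOn.congr fun t _ => fracInt_zero f t
  refine ContinuousOn.congr (f := fun t : ℝ => (Real.Gamma ν)⁻¹ • t ^ ν •
    ∫ x in (0 : ℝ)..1, (1 - x) ^ (ν - 1) • f (t * x)) ?_
    fun t ht => fracInt_eq_integral_unit hν ht f
  have h : Continuous fun t : ℝ => ∫ x in (0 : ℝ)..1, (1 - x) ^ (ν - 1) • f (t * x) := by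
    refine intervalIntegral.continuous_of_dominated_interval
      (bound := fun x => (1 - x) ^ (ν - 1) * M) (fun t => ?_)
      (fun t => Filter.Eventually.of_forall fun x hx => ?_)
      ((intervalIntegrable_kernel hν 1).mul_const M)
      (Filter.Eventually.of_forall fun x _ => by fun_prop)
    · refine (Measurable.aestronglyMeasurable (by fun_prop)).smul
        (Continuous.aestronglyMeasurable (by fun_prop))
    · rw [uIoc_of_le zero_le_one] at hx
      have : 0 ≤ (1 - x) ^ (ν - 1) := Real.rpow_nonneg (sub_nonneg.2 hx.2) _
      rw [norm_smul, Real.norm_of_nonneg this]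
      exact mul_le_mul_of_nonneg_left (hM _) this
  exact (((Real.continuous_rpow_const hν.le).smul h).const_smul _).continuousOn

/-- Euler's Beta integral B(p+1, ν), scaled to [0, t]; it is taken from the complex version, and the
casts bring it back to ℝ. -/
theorem integral_rpow_mul_kernel {p ν t : ℝ} (hp : 0 ≤ p) (hν : 0 < ν) (ht : 0 < t) :
    ∫ s in (0 : ℝ)..t, (t - s) ^ (ν - 1) * s ^ p =
      t ^ (p + ν) * (Real.Gamma (p + 1) * Real.Gamma ν / Real.Gamma (p + ν + 1)) := by
  have h := Complex.betaIntegral_scaled ((p + 1 : ℝ) : ℂ) (ν : ℂ) ht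
  rw [Complex.betaIntegral_eq_Gamma_mul_div _ _ (by simp; linarith) (by simpa using hν),
    ← Complex.ofReal_add, Complex.Gamma_ofReal, Complex.Gamma_ofReal, Complex.Gamma_ofReal] at h
  apply Complex.ofReal_injective
  rw [← intervalIntegral.integral_ofReal]
  have e1 : (((p + 1 + ν : ℝ) : ℂ) - 1) = ((p + ν : ℝ) : ℂ) := by push_cast; ring
  rw [e1, ← Complex.ofReal_cpow ht.le] at h
  rw [show p + ν + 1 = p + 1 + ν by ring]
  push_cast at h ⊢
  rw [← h]
  refine intervalIntegral.integral_congr fun s hs => ?_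
  rw [uIcc_of_le ht.le] at hs
  have e2 : ((p : ℂ) + 1 - 1) = (p : ℂ) := by ring
  have e3 : ((ν : ℂ) - 1) = ((ν - 1 : ℝ) : ℂ) := by push_cast; ring
  simp only [e2]
  rw [e3, ← Complex.ofReal_sub, ← Complex.ofReal_cpow hs.1,
    ← Complex.ofReal_cpow (sub_nonneg.2 hs.2), mul_comm]

theorem fracInt_rpow {p ν t : ℝ} (hp : 0 ≤ p) (hν : 0 ≤ ν) (ht : 0 ≤ t) :
    fracInt ν (fun s : ℝ => s ^ p) t =
      Real.Gamma (p + 1) / Real.Gamma (p + ν + 1) * t ^ (p + ν) := by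
  rcases hν.eq_or_lt with rfl | hν
  · rw [fracInt_zero, add_zero, div_self (Real.Gamma_pos_of_pos (by linarith)).ne', one_mul]
  rw [fracInt_of_pos hν]
  rcases ht.eq_or_lt with rfl | ht
  · simp [Real.zero_rpow (add_pos_of_nonneg_of_pos hp hν).ne']
  simp only [smul_eq_mul]
  rw [integral_rpow_mul_kernel hp hν ht]
  have := (Real.Gamma_pos_of_pos hν).ne'
  field_simp

end FracInt

/-! ### Fractional integrals as operators on C([0, T], F) -/

section Operator

theorem norm_IccExtend_le {F : Type*} [NormedAddCommGroup F] {T : ℝ} (hT : 0 ≤ T)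
    (f : C(Icc 0 T, F)) (s : ℝ) : ‖IccExtend hT f s‖ ≤ ‖f‖ :=
  f.norm_coe_le_norm _

variable {T : ℝ} (hT : 0 ≤ T)
variable {F G : Type*} [NormedAddCommGroup F] [NormedSpace ℝ F]
  [NormedAddCommGroup G] [NormedSpace ℝ G]

/-- The fractional integral of order `max ν 0` as a bounded operator on `C([0, T], F)`. -/
noncomputable def fracIntCLM (ν : ℝ) : C(Icc 0 T, F) →L[ℝ] C(Icc 0 T, F) :=
  LinearMap.mkContinuous
    -- The truncation makes the operator available without a sign hypothesis on ν; the constant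
    -- extension `IccExtend` supplies a function continuous and bounded on all of ℝ.
    { toFun := fun f => ⟨fun t => fracInt (max ν 0) (IccExtend hT f) t,
        (continuousOn_fracInt (le_max_right ν 0) f.continuous.Icc_extend'
          (norm_IccExtend_le hT f)).comp_continuous continuous_subtype_val fun t => t.2.1⟩
      map_add' := fun f g => by
        ext t
        exact fracInt_add (le_max_right ν 0) _ f.continuous.Icc_extend' g.continuous.Icc_extend'
      map_smul' := fun c f => by
        ext t
        exact fracInt_smul _ _ c (IccExtend hT f) }
    (T ^ (max ν 0) / Real.Gamma (max ν 0 + 1))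
    (fun f => by
      have hν := le_max_right ν 0
      have hG := Real.Gamma_pos_of_pos (add_pos_of_nonneg_of_pos hν one_pos)
      rw [ContinuousMap.norm_le _ (by positivity)]
      intro t
      refine (norm_fracInt_le hν t.2.1 (norm_IccExtend_le hT f)).trans ?_
      gcongr
      · exact t.2.1
      · exact t.2.2)

variable {hT}

theorem fracIntCLM_apply {ν : ℝ} (hν : 0 ≤ ν) (f : C(Icc 0 T, F)) (t : Icc (0 : ℝ) T) :
    fracIntCLM hT ν f t = fracInt ν (IccExtend hT f) t := by
  change fracInt (max ν 0) (IccExtend hT f) t = _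
  rw [max_eq_left hν]

theorem norm_fracIntCLM_le {ν : ℝ} (hν : 0 ≤ ν) :
    ‖(fracIntCLM hT ν : C(Icc 0 T, F) →L[ℝ] C(Icc 0 T, F))‖ ≤ T ^ ν / Real.Gamma (ν + 1) := by
  have hG := Real.Gamma_pos_of_pos (add_pos_of_nonneg_of_pos hν one_pos)
  refine ContinuousLinearMap.opNorm_le_bound _ (by positivity) fun f => ?_
  rw [ContinuousMap.norm_le _ (by positivity)]
  intro t
  rw [fracIntCLM_apply hν]
  refine (norm_fracInt_le hν t.2.1 (norm_IccExtend_le hT f)).trans ?_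
  gcongr
  · exact t.2.1
  · exact t.2.2

theorem fracInt_eq_fracIntCLM {ν : ℝ} (hν : 0 ≤ ν) {h : ℝ → F} (f : C(Icc 0 T, F))
    (hf : ∀ t : Icc (0 : ℝ) T, h t = f t) (t : Icc (0 : ℝ) T) :
    fracInt ν h t = fracIntCLM hT ν f t := by
  rw [fracIntCLM_apply hν]
  exact fracInt_congr (fun s hs => by rw [IccExtend_of_mem hT _ hs]; exact hf ⟨s, hs⟩) t.2

theorem fracIntCLM_zero (f : C(Icc 0 T, F)) : fracIntCLM hT 0 f = f := by
  ext t
  rw [fracIntCLM_apply le_rfl, fracInt_zero, IccExtend_val]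

theorem fracIntCLM_apply_zero {ν : ℝ} (hν : 0 < ν) (f : C(Icc 0 T, F)) (t : Icc (0 : ℝ) T)
    (ht : (t : ℝ) = 0) : fracIntCLM hT ν f t = 0 := by
  rw [fracIntCLM_apply hν.le, fracInt_of_pos hν, ht, intervalIntegral.integral_same, smul_zero]

theorem fracIntCLM_one_apply (f : C(Icc 0 T, F)) (t : Icc (0 : ℝ) T) :
    fracIntCLM hT 1 f t = ∫ s in (0 : ℝ)..t, IccExtend hT f s := by
  rw [fracIntCLM_apply zero_le_one, fracInt_of_pos one_pos]
  simp

variable (T) in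
/-- Pointwise application of a bounded operator to continuous functions on `[0, T]`. -/
noncomputable def mapCLM (L : F →L[ℝ] G) : C(Icc 0 T, F) →L[ℝ] C(Icc 0 T, G) :=
  L.compLeftContinuous ℝ (Icc (0 : ℝ) T)

theorem mapCLM_apply (L : F →L[ℝ] G) (f : C(Icc 0 T, F)) (t : Icc (0 : ℝ) T) :
    mapCLM T L f t = L (f t) := rfl

theorem norm_mapCLM_le (L : F →L[ℝ] G) : ‖mapCLM T L‖ ≤ ‖L‖ := by
  refine ContinuousLinearMap.opNorm_le_bound _ (norm_nonneg L) fun f => ?_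
  rw [ContinuousMap.norm_le _ (by positivity)]
  exact fun t => L.le_opNorm_of_le (f.norm_coe_le_norm t)

theorem fracIntCLM_mapCLM [CompleteSpace F] [CompleteSpace G] {ν : ℝ} (hν : 0 ≤ ν) (L : F →L[ℝ] G)
    (f : C(Icc 0 T, F)) :
    fracIntCLM hT ν (mapCLM T L f) = mapCLM T L (fracIntCLM hT ν f) := by
  ext t
  rw [fracIntCLM_apply hν, mapCLM_apply, fracIntCLM_apply hν,
    ← fracInt_clm hν _ f.continuous.Icc_extend' L]
  rfl

variable (T) in
/-- The power function of nonnegative exponent as a continuous function on `[0, T]`. -/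
noncomputable def rpowMap (p : ℝ) (hp : 0 ≤ p) : C(Icc 0 T, ℝ) :=
  ⟨fun t => (t : ℝ) ^ p, (Real.continuous_rpow_const hp).comp continuous_subtype_val⟩

theorem fracIntCLM_rpowMap {p ν : ℝ} (hp : 0 ≤ p) (hν : 0 ≤ ν) :
    fracIntCLM hT ν (rpowMap T p hp) =
      (Real.Gamma (p + 1) / Real.Gamma (p + ν + 1)) • rpowMap T (p + ν) (add_nonneg hp hν) := by
  ext t
  rw [← fracInt_eq_fracIntCLM hν (h := fun s => s ^ p) _ (fun s => rfl), fracInt_rpow hp hν t.2.1]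
  rfl

/-- Both sides are bounded operators, so they agree on a closed subspace. It contains the powers,
where the Gamma quotients telescope, hence the polynomials, which are dense by Weierstrass. No
Fubini argument is needed. -/
theorem fracIntCLM_comp_real {μ ν : ℝ} (hμ : 0 ≤ μ) (hν : 0 ≤ ν) (f : C(Icc 0 T, ℝ)) :
    fracIntCLM hT μ (fracIntCLM hT ν f) = fracIntCLM hT (μ + ν) f := by
  let K : Submodule ℝ C(Icc 0 T, ℝ) :=
    LinearMap.eqLocus ((fracIntCLM hT μ ∘L fracIntCLM hT ν : C(Icc 0 T, ℝ) →L[ℝ] C(Icc 0 T, ℝ)) :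
      C(Icc 0 T, ℝ) →ₗ[ℝ] C(Icc 0 T, ℝ)) (fracIntCLM hT (μ + ν) : C(Icc 0 T, ℝ) →L[ℝ] C(Icc 0 T, ℝ))
  have hK : IsClosed (K : Set C(Icc 0 T, ℝ)) :=
    isClosed_eq (fracIntCLM hT μ ∘L fracIntCLM hT ν).continuous (fracIntCLM hT (μ + ν)).continuous
  have hpow : ∀ p : ℝ, ∀ hp : 0 ≤ p, rpowMap T p hp ∈ K := by
    intro p hp
    change fracIntCLM hT μ (fracIntCLM hT ν (rpowMap T p hp)) =
      fracIntCLM hT (μ + ν) (rpowMap T p hp)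
    rw [fracIntCLM_rpowMap hp hν, map_smul, fracIntCLM_rpowMap _ hμ,
      fracIntCLM_rpowMap _ (add_nonneg hμ hν), smul_smul]
    have e : p + (μ + ν) = p + ν + μ := by ring
    have h1 := (Real.Gamma_pos_of_pos (show 0 < p + ν + 1 by linarith)).ne'
    simp only [e]
    congr 1
    field_simp
  have hpoly : ∀ q : Polynomial ℝ, q.toContinuousMapOn (Icc 0 T) ∈ K := by
    intro q
    induction q using Polynomial.induction_on' with
    | add q r hq hr =>
      have : (q + r).toContinuousMapOn (Icc 0 T) =
          q.toContinuousMapOn (Icc 0 T) + r.toContinuousMapOn (Icc 0 T) := by ext; simp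
      rw [this]
      exact K.add_mem hq hr
    | monomial n c =>
      have : (Polynomial.monomial n c).toContinuousMapOn (Icc 0 T) =
          c • rpowMap T n n.cast_nonneg := by
        ext t
        simp [rpowMap]
      rw [this]
      exact K.smul_mem c (hpow _ _)
  have hmem := continuousMap_mem_polynomialFunctions_closure 0 T f
  have hsub : ((polynomialFunctions (Icc 0 T) : Subalgebra ℝ C(Icc 0 T, ℝ)) :
      Set C(Icc 0 T, ℝ)) ⊆ K := by
    rintro _ ⟨q, -, rfl⟩
    exact hpoly q
  exact closure_minimal hsub hK hmem

/-- The semigroup property of fractional integrals. -/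
theorem fracIntCLM_comp [CompleteSpace F] {μ ν : ℝ} (hμ : 0 ≤ μ) (hν : 0 ≤ ν)
    (f : C(Icc 0 T, F)) :
    fracIntCLM hT μ (fracIntCLM hT ν f) = fracIntCLM hT (μ + ν) f := by
  ext t
  -- Continuous functionals separate points and commute with I^ν, which reduces the claim to scalar
  -- functions.
  refine (SeparatingDual.eq_iff_forall_dual_eq (R := ℝ)).2 fun L => ?_
  have h := congrArg (fun k => k t)
    (fracIntCLM_comp_real (hT := hT) hμ hν (mapCLM T L f))
  simpa only [fracIntCLM_mapCLM hμ, fracIntCLM_mapCLM hν, fracIntCLM_mapCLM (add_nonneg hμ hν),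
    mapCLM_apply] using h

theorem fracIntCLM_comm [CompleteSpace F] {μ ν : ℝ} (hμ : 0 ≤ μ) (hν : 0 ≤ ν)
    (f : C(Icc 0 T, F)) :
    fracIntCLM hT μ (fracIntCLM hT ν f) = fracIntCLM hT ν (fracIntCLM hT μ f) := by
  rw [fracIntCLM_comp hμ hν, fracIntCLM_comp hν hμ, add_comm]

end Operator

theorem summable_clm_of_opNorm_le {ι V W : Type*} [NormedAddCommGroup V] [NormedSpace ℝ V]
    [NormedAddCommGroup W] [NormedSpace ℝ W] [CompleteSpace W] {f : ι → V →L[ℝ] W} {g : ι → ℝ}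
    (h : ∀ i, ‖f i‖ ≤ g i) (hg : Summable g) : Summable f :=
  Summable.of_norm_bounded hg h

/-! ### The Neumann series of the Volterra operator -/

section Volterra

variable {T : ℝ} (hT : 0 ≤ T) {Y : Type*} [NormedAddCommGroup Y] [NormedSpace ℝ Y]
  (a b : ℝ) (A B : Y →L[ℝ] Y)

/-- The Volterra operator `A I^a + B I^b`. -/
noncomputable def volterra : C(Icc 0 T, Y) →L[ℝ] C(Icc 0 T, Y) :=
  mapCLM T A ∘L fracIntCLM hT a + mapCLM T B ∘L fracIntCLM hT b

/-- The sum of the products of `k` factors `A I^a` and `m` factors `B I^b`. -/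
noncomputable def volterraTerm (k m : ℕ) : C(Icc 0 T, Y) →L[ℝ] C(Icc 0 T, Y) :=
  mapCLM T (Q A B k m) ∘L fracIntCLM hT ((k : ℝ) * a + (m : ℝ) * b)

/-- The Neumann series of the Volterra operator. -/
noncomputable def resolvent : C(Icc 0 T, Y) →L[ℝ] C(Icc 0 T, Y) :=
  ∑' p : ℕ × ℕ, volterraTerm hT a b A B p.1 p.2

variable {hT a b}

theorem norm_volterraTerm_le (ha : 0 ≤ a) (hb : 0 ≤ b) (k m : ℕ) :
    ‖volterraTerm hT a b A B k m‖ ≤ T ^ ((k : ℝ) * a + (m : ℝ) * b) /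
      Real.Gamma ((k : ℝ) * a + (m : ℝ) * b + 1) * ‖Q A B k m‖ := by
  have h1 := norm_mapCLM_le (T := T) (Q A B k m)
  have h2 := norm_fracIntCLM_le (F := Y) (hT := hT) (index_nonneg ha hb k m)
  have h3 := ContinuousLinearMap.opNorm_comp_le (mapCLM T (Q A B k m))
    (fracIntCLM hT ((k : ℝ) * a + (m : ℝ) * b))
  rw [mul_comm]
  exact h3.trans (mul_le_mul h1 h2 (ContinuousLinearMap.opNorm_nonneg _) (norm_nonneg _))

theorem summable_volterraTerm [CompleteSpace Y] (ha : 0 < a) (hb : 0 < b) :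
    Summable fun p : ℕ × ℕ => volterraTerm hT a b A B p.1 p.2 :=
  summable_clm_of_opNorm_le (fun p => norm_volterraTerm_le A B ha.le hb.le p.1 p.2)
    (summable_norm_Q_mul A B ha hb one_pos hT)

theorem volterraTerm_apply (k m : ℕ) (f : C(Icc 0 T, Y)) :
    volterraTerm hT a b A B k m f =
      mapCLM T (Q A B k m) (fracIntCLM hT ((k : ℝ) * a + (m : ℝ) * b) f) := rfl

theorem mapCLM_mul (L M : Y →L[ℝ] Y) (f : C(Icc 0 T, Y)) :
    mapCLM T (L * M) f = mapCLM T L (mapCLM T M f) := rfl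

theorem mapCLM_add (L M : Y →L[ℝ] Y) (f : C(Icc 0 T, Y)) :
    mapCLM T (L + M) f = mapCLM T L f + mapCLM T M f := rfl

theorem volterraTerm_zero_zero (f : C(Icc 0 T, Y)) : volterraTerm hT a b A B 0 0 f = f := by
  rw [volterraTerm_apply]
  simp only [Nat.cast_zero, zero_mul, add_zero, fracIntCLM_zero, Q_zero_left, pow_zero]
  rfl

variable [CompleteSpace Y]

/-- Composing with A I^a or B I^b on the left prepends a letter and raises the order of integration
accordingly, so the first-letter recursion of `Q` becomes S = 1 + VS. -/
theorem resolvent_eq_left (ha : 0 < a) (hb : 0 < b) :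
    resolvent hT a b A B = ContinuousLinearMap.id ℝ _ +
      (mapCLM T A ∘L fracIntCLM hT a) ∘L resolvent hT a b A B +
      (mapCLM T B ∘L fracIntCLM hT b) ∘L resolvent hT a b A B := by
  have hI := fun k m => index_nonneg ha.le hb.le k m
  have hA : ∀ k m : ℕ, ((k + 1 : ℕ) : ℝ) * a + (m : ℝ) * b = a + ((k : ℝ) * a + (m : ℝ) * b) :=
    fun k m => by push_cast; ring
  have hB : ∀ k m : ℕ, (k : ℝ) * a + ((m + 1 : ℕ) : ℝ) * b = b + ((k : ℝ) * a + (m : ℝ) * b) :=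
    fun k m => by push_cast; ring
  have h := tsum_eq_of_two_term_recursion
    (ContinuousLinearMap.compL ℝ C(Icc 0 T, Y) C(Icc 0 T, Y) C(Icc 0 T, Y)
      (mapCLM T A ∘L fracIntCLM hT a))
    (ContinuousLinearMap.compL ℝ C(Icc 0 T, Y) C(Icc 0 T, Y) C(Icc 0 T, Y)
      (mapCLM T B ∘L fracIntCLM hT b))
    (volterraTerm hT a b A B) (summable_volterraTerm A B ha hb)
    (fun k => ?_) (fun m => ?_) (fun k m => ?_)
  · rw [show volterraTerm hT a b A B 0 0 = ContinuousLinearMap.id ℝ _ from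
      ContinuousLinearMap.ext (volterraTerm_zero_zero A B)] at h
    exact h
  all_goals
    ext1 f
    simp only [ContinuousLinearMap.compL_apply, ContinuousLinearMap.comp_apply, add_apply,
      volterraTerm_apply, fracIntCLM_mapCLM ha.le, fracIntCLM_mapCLM hb.le,
      fracIntCLM_comp ha.le (hI _ _), fracIntCLM_comp hb.le (hI _ _), ← mapCLM_mul]
  · rw [Q_succ_zero, hA]
  · rw [Q_zero_succ, hB]
  · rw [Q_succ_succ, mapCLM_add, ← hA, ← hB]

/-- The mirror image, S = 1 + SV, from the last-letter recursion. It is a separate fact because A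
and B need not commute. -/
theorem resolvent_eq_right (ha : 0 < a) (hb : 0 < b) :
    resolvent hT a b A B = ContinuousLinearMap.id ℝ _ +
      resolvent hT a b A B ∘L (mapCLM T A ∘L fracIntCLM hT a) +
      resolvent hT a b A B ∘L (mapCLM T B ∘L fracIntCLM hT b) := by
  have hI := fun k m => index_nonneg ha.le hb.le k m
  have hA : ∀ k m : ℕ, ((k + 1 : ℕ) : ℝ) * a + (m : ℝ) * b = (k : ℝ) * a + (m : ℝ) * b + a :=
    fun k m => by push_cast; ring
  have hB : ∀ k m : ℕ, (k : ℝ) * a + ((m + 1 : ℕ) : ℝ) * b = (k : ℝ) * a + (m : ℝ) * b + b :=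
    fun k m => by push_cast; ring
  have h := tsum_eq_of_two_term_recursion
    ((ContinuousLinearMap.compL ℝ C(Icc 0 T, Y) C(Icc 0 T, Y) C(Icc 0 T, Y)).flip
      (mapCLM T A ∘L fracIntCLM hT a))
    ((ContinuousLinearMap.compL ℝ C(Icc 0 T, Y) C(Icc 0 T, Y) C(Icc 0 T, Y)).flip
      (mapCLM T B ∘L fracIntCLM hT b))
    (volterraTerm hT a b A B) (summable_volterraTerm A B ha hb)
    (fun k => ?_) (fun m => ?_) (fun k m => ?_)
  · rw [show volterraTerm hT a b A B 0 0 = ContinuousLinearMap.id ℝ _ from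
      ContinuousLinearMap.ext (volterraTerm_zero_zero A B)] at h
    exact h
  all_goals
    ext1 f
    simp only [ContinuousLinearMap.compL_apply, ContinuousLinearMap.flip_apply,
      ContinuousLinearMap.comp_apply, add_apply,
      volterraTerm_apply, fracIntCLM_mapCLM (hI _ _),
      fracIntCLM_comp (hI _ _) ha.le, fracIntCLM_comp (hI _ _) hb.le, ← mapCLM_mul]
  · rw [Q_succ_zero', hA]
  · rw [Q_zero_succ', hB]
  · rw [Q_succ_succ', mapCLM_add, ← hA, ← hB]

/-- The resolvent solves the linear Volterra equation, uniquely. -/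
theorem eq_add_volterra_iff (ha : 0 < a) (hb : 0 < b) (f w : C(Icc 0 T, Y)) :
    w = f + volterra hT a b A B w ↔ w = resolvent hT a b A B f := by
  constructor
  -- Uniqueness: Sw = w + SVw by the right identity and Sw = Sf + SVw by the equation, so w = Sf.
  · intro h
    have h1 := congrArg (fun S => S w) (resolvent_eq_right (hT := hT) A B ha hb)
    have h2 : resolvent hT a b A B w =
        resolvent hT a b A B f + resolvent hT a b A B (volterra hT a b A B w) := by
      rw [← map_add, ← h]
    simp only [add_apply, ContinuousLinearMap.comp_apply,
      ContinuousLinearMap.id_apply] at h1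
    simp only [volterra, add_apply, ContinuousLinearMap.comp_apply,
      map_add] at h2
    rw [h2, add_assoc] at h1
    exact (add_right_cancel h1).symm
  · intro h
    have h1 := congrArg (fun S => S f) (resolvent_eq_left (hT := hT) A B ha hb)
    simp only [add_apply, ContinuousLinearMap.comp_apply,
      ContinuousLinearMap.id_apply, ← h] at h1
    rw [volterra, add_apply, ← add_assoc]
    exact h1

theorem hasSum_resolvent_apply (ha : 0 < a) (hb : 0 < b) (f : C(Icc 0 T, Y)) :
    HasSum (fun p : ℕ × ℕ => volterraTerm hT a b A B p.1 p.2 f) (resolvent hT a b A B f) :=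
  (summable_volterraTerm A B ha hb).hasSum.mapL (ContinuousLinearMap.apply ℝ _ f)

/-- Each term of the series is a constant operator composed with a fractional integral, and both
commute with I^ν. With ν = 1 this gives the differentiability of solutions. -/
theorem fracIntCLM_resolvent (ha : 0 < a) (hb : 0 < b) {ν : ℝ} (hν : 0 ≤ ν) (f : C(Icc 0 T, Y)) :
    fracIntCLM hT ν (resolvent hT a b A B f) = resolvent hT a b A B (fracIntCLM hT ν f) := by
  refine ((hasSum_resolvent_apply A B ha hb f).mapL (fracIntCLM hT ν)).unique ?_
  convert hasSum_resolvent_apply A B ha hb (fracIntCLM hT ν f) using 2 with p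
  rw [volterraTerm_apply, volterraTerm_apply, fracIntCLM_mapCLM hν,
    fracIntCLM_comm hν (index_nonneg ha.le hb.le _ _)]

end Volterra

/-! ### The resolvent on explicit data -/

section Representation

variable {T : ℝ} {hT : 0 ≤ T} {F Y X : Type*} [NormedAddCommGroup F] [NormedSpace ℝ F]
  [NormedAddCommGroup Y] [NormedSpace ℝ Y] [NormedAddCommGroup X] [NormedSpace ℝ X]

variable (T) in
/-- The function `t ↦ t ^ p • ζ` on `[0, T]`. -/
noncomputable def rpowSMul (p : ℝ) (hp : 0 ≤ p) (ζ : F) : C(Icc 0 T, F) :=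
  mapCLM T (ContinuousLinearMap.toSpanSingleton ℝ ζ) (rpowMap T p hp)

theorem rpowSMul_apply {p : ℝ} (hp : 0 ≤ p) (ζ : F) (t : Icc (0 : ℝ) T) :
    rpowSMul T p hp ζ t = (t : ℝ) ^ p • ζ := rfl

theorem rpowSMul_zero_apply (ζ : F) (t : Icc (0 : ℝ) T) : rpowSMul T 0 le_rfl ζ t = ζ := by
  rw [rpowSMul_apply, Real.rpow_zero, one_smul]

theorem rpowSMul_one_apply (ζ : F) (t : Icc (0 : ℝ) T) :
    rpowSMul T 1 zero_le_one ζ t = (t : ℝ) • ζ := by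
  rw [rpowSMul_apply, Real.rpow_one]

theorem mapCLM_rpowSMul {p : ℝ} (hp : 0 ≤ p) (ζ : F) (L : F →L[ℝ] Y) :
    mapCLM T L (rpowSMul T p hp ζ) = rpowSMul T p hp (L ζ) := by
  ext t
  rw [mapCLM_apply, rpowSMul_apply, rpowSMul_apply, map_smul]

theorem fracIntCLM_rpowSMul [CompleteSpace F] {p ν : ℝ} (hp : 0 ≤ p) (hν : 0 ≤ ν) (ζ : F) :
    fracIntCLM hT ν (rpowSMul T p hp ζ) =
      (Real.Gamma (p + 1) / Real.Gamma (p + ν + 1)) • rpowSMul T (p + ν) (add_nonneg hp hν) ζ := by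
  rw [rpowSMul, fracIntCLM_mapCLM hν, fracIntCLM_rpowMap hp hν, map_smul]
  rfl

theorem fracIntCLM_one_rpowSMul_zero [CompleteSpace F] (ζ : F) :
    fracIntCLM hT 1 (rpowSMul T 0 le_rfl ζ) = rpowSMul T 1 zero_le_one ζ := by
  rw [fracIntCLM_rpowSMul le_rfl zero_le_one]
  ext t
  simp [rpowSMul_apply, Real.Gamma_add_one]

variable {a b : ℝ} (A B : Y →L[ℝ] Y)

theorem continuousOn_ml (ha : 0 < a) (hb : 0 < b) {c : ℝ} (hc : 0 < c) [CompleteSpace Y] :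
    ContinuousOn (ml a b c A B) (Icc 0 T) := by
  rcases lt_or_ge T 0 with hT | hT
  · rw [Icc_eq_empty hT.not_ge]; exact continuousOn_empty _
  have h : ContinuousOn (fun t => ∑' p : ℕ × ℕ, mlTerm a b c A B t p.1 p.2) (Icc 0 T) := by
    -- Weierstrass M-test: the norms of the terms increase with t, so their values at T are a
    -- majorant.
    refine continuousOn_tsum (fun p => ?_) (summable_norm_mlTerm A B ha hb hc hT)
      fun p t ht => ?_
    · have := Real.continuous_rpow_const (index_nonneg ha.le hb.le p.1 p.2)
      exact ((this.div_const _).smul continuous_const).continuousOn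
    · have hn := index_nonneg ha.le hb.le p.1 p.2
      have := Real.Gamma_pos_of_pos (add_pos_of_nonneg_of_pos hn hc)
      rw [norm_mlTerm A B ha hb hc ht.1, norm_mlTerm A B ha hb hc hT]
      gcongr
      · exact ht.1
      · exact ht.2
  exact h.congr fun t ht => (hasSum_ml A B ha hb hc ht.1).tsum_eq.symm

theorem intervalIntegrable_ml [CompleteSpace Y] (ha : 0 < a) (hb : 0 < b) (L : Y →L[ℝ] X)
    {g : ℝ → Y} (hg : ContinuousOn g (Icc 0 T)) {t : ℝ} (ht : t ∈ Icc 0 T) :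
    IntervalIntegrable (fun s => ((t - s) ^ (b - 1) • (L ∘L ml a b b A B (t - s))) (g s))
      volume 0 t := by
  have hc : ContinuousOn (fun s => L (ml a b b A B (t - s) (g s))) (uIcc 0 t) := by
    rw [uIcc_of_le ht.1]
    refine L.continuous.comp_continuousOn (ContinuousOn.clm_apply ?_ (hg.mono ?_))
    · exact (continuousOn_ml (T := t) A B ha hb hb).comp (by fun_prop)
        fun s hs => ⟨sub_nonneg.2 hs.2, by linarith [hs.1]⟩
    · exact Icc_subset_Icc_right ht.2
  exact (intervalIntegrable_kernel hb t).smul_continuousOn hc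

theorem rpow_smul_mlTerm {t d : ℝ} (ht : 0 ≤ t) (hd : 0 ≤ d) (ha : 0 ≤ a) (hb : 0 ≤ b) (c : ℝ)
    (k m : ℕ) : t ^ d • mlTerm a b c A B t k m =
      (t ^ ((k : ℝ) * a + (m : ℝ) * b + d) / Real.Gamma ((k : ℝ) * a + (m : ℝ) * b + c)) •
        Q A B k m := by
  rw [mlTerm, smul_smul, Real.rpow_add_of_nonneg ht (index_nonneg ha hb k m) hd]
  congr 1
  ring

variable [CompleteSpace Y]

theorem hasSum_resolvent_apply_apply (ha : 0 < a) (hb : 0 < b) (f : C(Icc 0 T, Y))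
    (t : Icc (0 : ℝ) T) :
    HasSum (fun p : ℕ × ℕ => Q A B p.1 p.2 (fracIntCLM hT ((p.1 : ℝ) * a + (p.2 : ℝ) * b) f t))
      (resolvent hT a b A B f t) :=
  (hasSum_resolvent_apply A B ha hb f).mapL (ContinuousMap.evalCLM ℝ t)

theorem rpow_smul_ml_eq_tsum [CompleteSpace X] {t d : ℝ} (ht : 0 ≤ t) (hd : 0 ≤ d)
    (ha : 0 < a) (hb : 0 < b) {c : ℝ} (hc : 0 < c) (L : Y →L[ℝ] X) (N : Y →L[ℝ] Y) :
    t ^ d • (L ∘L ml a b c A B t ∘L N) = ∑' k : ℕ, ∑' m : ℕ,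
      (t ^ ((k : ℝ) * a + (m : ℝ) * b + d) / Real.Gamma ((k : ℝ) * a + (m : ℝ) * b + c)) •
        (L ∘L Q A B k m ∘L N) := by
  have h := ((hasSum_ml A B ha hb hc ht).mapL (ContinuousLinearMap.compL ℝ Y Y X L ∘L
    (ContinuousLinearMap.compL ℝ Y Y Y).flip N)).const_smul (t ^ d)
  rw [← map_smul] at h
  simp only [← map_smul, rpow_smul_mlTerm A B ht hd ha.le hb.le c] at h
  simp only [map_smul, ContinuousLinearMap.comp_apply, ContinuousLinearMap.flip_apply,
    ContinuousLinearMap.compL_apply] at h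
  rw [← h.tsum_eq, h.summable.tsum_prod]

/-- Applying I^(ka+mb) to t^p produces the quotient Γ(p+1)/Γ(ka+mb+p+1). The numerator is common to
all terms and the denominators are those of `ml` with c = p + 1. -/
theorem resolvent_rpowSMul (ha : 0 < a) (hb : 0 < b) {p : ℝ} (hp : 0 ≤ p) (ζ : Y)
    (t : Icc (0 : ℝ) T) :
    resolvent hT a b A B (rpowSMul T p hp ζ) t =
      Real.Gamma (p + 1) • (t : ℝ) ^ p • ml a b (p + 1) A B t ζ := by
  refine (hasSum_resolvent_apply_apply A B ha hb _ t).unique ?_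
  have h := ((hasSum_ml A B ha hb (add_pos_of_nonneg_of_pos hp one_pos) t.2.1).mapL
    (ContinuousLinearMap.apply ℝ Y ζ)).const_smul (Real.Gamma (p + 1) * (t : ℝ) ^ p)
  rw [mul_smul] at h
  convert! h using 2 with q
  have hI := index_nonneg ha.le hb.le q.1 q.2
  rw [fracIntCLM_rpowSMul hp hI]
  simp only [ContinuousMap.smul_apply, rpowSMul_apply, mlTerm, map_smul,
    ContinuousLinearMap.apply_apply, smul_smul]
  rw [add_comm p (_ + _), Real.rpow_add_of_nonneg t.2.1 hI hp, ← add_assoc]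
  congr 1
  ring

/-- By the semigroup law I^(ka+mb) I^b is a single convolution; pulling (t-s)^(b-1) out of its
kernel leaves `mlTerm`, and dominated convergence exchanges sum and integral. -/
theorem resolvent_fracIntCLM (ha : 0 < a) (hb : 0 < b) {g : ℝ → Y} (G : C(Icc 0 T, Y))
    (hG : ∀ t : Icc (0 : ℝ) T, g t = G t) (t : Icc (0 : ℝ) T) :
    resolvent hT a b A B (fracIntCLM hT b G) t =
      ∫ s in (0 : ℝ)..t, (t - s : ℝ) ^ (b - 1) • ml a b b A B (t - s) (g s) := by
  refine (hasSum_resolvent_apply_apply A B ha hb _ t).unique ?_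
  have hcongr : ∀ s ∈ uIcc 0 (t : ℝ), g s = IccExtend hT G s := by
    intro s hs
    rw [uIcc_of_le t.2.1] at hs
    have hs' : s ∈ Icc 0 T := ⟨hs.1, hs.2.trans t.2.2⟩
    rw [IccExtend_of_mem hT _ hs']
    exact hG ⟨s, hs'⟩
  rw [intervalIntegral.integral_congr (g := fun s => (t - s : ℝ) ^ (b - 1) •
    ml a b b A B (t - s) (IccExtend hT G s)) fun s hs => by simp only [hcongr s hs]]
  have hGc : Continuous (IccExtend hT G) := G.continuous.Icc_extend'
  have hterm : ∀ p : ℕ × ℕ, Q A B p.1 p.2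
      (fracIntCLM hT ((p.1 : ℝ) * a + (p.2 : ℝ) * b) (fracIntCLM hT b G) t) =
      ∫ s in (0 : ℝ)..t, (t - s : ℝ) ^ (b - 1) •
        mlTerm a b b A B (t - s) p.1 p.2 (IccExtend hT G s) := by
    intro p
    have hI := index_nonneg ha.le hb.le p.1 p.2
    have hIb := add_pos_of_nonneg_of_pos hI hb
    rw [fracIntCLM_comp hI hb.le, fracIntCLM_apply hIb.le, fracInt_of_pos hIb, map_smul,
      ← ContinuousLinearMap.intervalIntegral_comp_comm _ (intervalIntegrable_kernel_smul hIb _ hGc),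
      ← intervalIntegral.integral_smul]
    -- The open interval matters: splitting the power, with b - 1 possibly negative, requires t - s
    -- > 0.
    refine intervalIntegral.integral_congr_uIoo fun s hs => ?_
    rw [uIoo_of_le t.2.1] at hs
    simp only [mlTerm, map_smul, smul_apply, smul_smul]
    rw [add_sub_assoc, Real.rpow_add (sub_pos.2 hs.2)]
    congr 1
    ring
  simp only [hterm]
  have hM := norm_IccExtend_le hT G
  -- The majorant evaluates the terms at t instead of t - s, leaving only the integrable kernel
  -- dependent on s.
  refine intervalIntegral.hasSum_integral_of_dominated_convergence
    (bound := fun p s => (t - s : ℝ) ^ (b - 1) * ‖mlTerm a b b A B t p.1 p.2‖ * ‖G‖)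
    (fun p => ?_) (fun p => Filter.Eventually.of_forall fun s hs => ?_)
    (Filter.Eventually.of_forall fun s hs => ?_) ?_
    (Filter.Eventually.of_forall fun s hs => ?_)
  · have h1 := Real.continuous_rpow_const (index_nonneg ha.le hb.le p.1 p.2)
    have h2 : Continuous fun s => mlTerm a b b A B (t - s) p.1 p.2 (IccExtend hT G s) :=
      (((h1.comp (continuous_const.sub continuous_id)).div_const _).smul
        continuous_const).clm_apply hGc
    exact (Measurable.aestronglyMeasurable (by fun_prop)).smul h2.aestronglyMeasurable
  · rw [uIoc_of_le t.2.1] at hs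
    have h0 : 0 ≤ (t : ℝ) - s := sub_nonneg.2 hs.2
    have hG := Real.Gamma_pos_of_pos
      (add_pos_of_nonneg_of_pos (index_nonneg ha.le hb.le p.1 p.2) hb)
    have h1 : ‖mlTerm a b b A B (t - s) p.1 p.2‖ ≤ ‖mlTerm a b b A B t p.1 p.2‖ := by
      rw [norm_mlTerm A B ha hb hb h0, norm_mlTerm A B ha hb hb t.2.1]
      gcongr
      linarith [hs.1]
    rw [norm_smul, Real.norm_of_nonneg (Real.rpow_nonneg h0 _), mul_assoc]
    refine mul_le_mul_of_nonneg_left ?_ (Real.rpow_nonneg h0 _)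
    exact (ContinuousLinearMap.le_opNorm _ _).trans
      (mul_le_mul h1 (hM s) (norm_nonneg _) (norm_nonneg _))
  · exact ((summable_norm_mlTerm A B ha hb hb t.2.1).mul_left _).mul_right _
  · simp only [tsum_mul_left, tsum_mul_right]
    exact ((intervalIntegrable_kernel hb _).mul_const _).mul_const _
  · rw [uIoc_of_le t.2.1] at hs
    exact ((hasSum_ml A B ha hb hb (sub_nonneg.2 hs.2)).mapL
      (ContinuousLinearMap.apply ℝ Y (IccExtend hT G s))).const_smul _

end Representation

/-! ### Mild solutions and the Volterra equation -/

section Mild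

variable {X Y : Type*} [NormedAddCommGroup X] [NormedSpace ℝ X]
  [NormedAddCommGroup Y] [NormedSpace ℝ Y]

/-- `R` is the inverse of `E`, `A = A₀ R` and `B = B₀ R`. -/
structure IsFactorization (E A₀ B₀ : X →ₗ.[ℝ] Y) (R : Y →L[ℝ] X) (A B : Y →L[ℝ] Y) : Prop where
  mem_E : ∀ z, R z ∈ E.domain
  app_E : ∀ z, app E (R z) = z
  inv_app : ∀ v ∈ E.domain, R (app E v) = v
  mem_A : ∀ z, R z ∈ A₀.domain
  app_A : ∀ z, app A₀ (R z) = A z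
  app_B : ∀ z, app B₀ (R z) = B z

theorem isFactorization_compInv {E A₀ B₀ : X →ₗ.[ℝ] Y} (hE : Function.Bijective E)
    (hEA : E.domain ≤ A₀.domain) (hEB : E.domain ≤ B₀.domain) {R : Y →L[ℝ] X} {A B : Y →L[ℝ] Y}
    (hR : ∀ z, R z = invE E hE z) (hA : ∀ z, A z = compInv A₀ E hE hEA z)
    (hB : ∀ z, B z = compInv B₀ E hE hEB z) : IsFactorization E A₀ B₀ R A B := by
  have hmem : ∀ z, R z ∈ E.domain := fun z => by
    rw [hR]; exact ((domEquiv E hE).symm z).2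
  refine ⟨hmem, fun z => ?_, fun v hv => ?_, fun z => hEA (hmem z), fun z => ?_, fun z => ?_⟩
  · rw [app_of_mem E (hmem z)]
    have : (⟨R z, hmem z⟩ : E.domain) = (domEquiv E hE).symm z := Subtype.ext (hR z)
    rw [this]
    exact (domEquiv E hE).apply_symm_apply z
  · rw [app_of_mem E hv, hR]
    exact congrArg Subtype.val ((domEquiv E hE).symm_apply_apply ⟨v, hv⟩)
  · rw [app_of_mem A₀ (hEA (hmem z)), hA]
    have : (⟨R z, hEA (hmem z)⟩ : A₀.domain) =
        Submodule.inclusion hEA ((domEquiv E hE).symm z) := Subtype.ext (hR z)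
    rw [this]
    rfl
  · rw [app_of_mem B₀ (hEB (hmem z)), hB]
    have : (⟨R z, hEB (hmem z)⟩ : B₀.domain) =
        Submodule.inclusion hEB ((domEquiv E hE).symm z) := Subtype.ext (hR z)
    rw [this]
    rfl

theorem app_zero (S : X →ₗ.[ℝ] Y) : app S 0 = 0 := by
  rw [app_of_mem S S.domain.zero_mem]
  exact S.map_zero

variable {T : ℝ} (hT : 0 ≤ T) (a b : ℝ) (A B : Y →L[ℝ] Y) (η η' : Y) (G u : C(Icc 0 T, Y))

/-- The integral equation satisfied by `u = E y` for a mild solution `y`. -/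
def IntegralEquation : Prop :=
  u = rpowSMul T 0 le_rfl η + rpowSMul T 1 zero_le_one η'
    + mapCLM T A (fracIntCLM hT a (u - rpowSMul T 0 le_rfl η))
    + fracIntCLM hT b (mapCLM T B u + G)

variable {hT a b A B η η' G u}

/-- A acts on u - η but B acts on u. Taking u - η as the unknown moves I^α(Bη) into the data, whence
the extra B in the η-term of the formula. -/
theorem integralEquation_iff [CompleteSpace Y] (ha : 0 < a) (hb : 0 < b) :
    IntegralEquation hT a b A B η η' G u ↔ u - rpowSMul T 0 le_rfl η = resolvent hT a b A B
      (rpowSMul T 1 zero_le_one η' + fracIntCLM hT b (rpowSMul T 0 le_rfl (B η))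
        + fracIntCLM hT b G) := by
  rw [← eq_add_volterra_iff A B ha hb, IntegralEquation, sub_eq_iff_eq_add]
  have h : mapCLM T B u = mapCLM T B (u - rpowSMul T 0 le_rfl η) + rpowSMul T 0 le_rfl (B η) := by
    rw [map_sub, mapCLM_rpowSMul, sub_add_cancel]
  rw [h]
  simp only [volterra, map_add, add_apply, ContinuousLinearMap.comp_apply,
    fracIntCLM_mapCLM hb.le]
  refine Eq.congr rfl ?_
  abel

theorem IntegralEquation.apply_zero (h : IntegralEquation hT a b A B η η' G u) (ha : 0 < a)
    (hb : 0 < b) : u ⟨0, left_mem_Icc.2 hT⟩ = η := by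
  rw [h]
  simp only [ContinuousMap.add_apply, mapCLM_apply, rpowSMul_zero_apply, rpowSMul_one_apply]
  rw [fracIntCLM_apply_zero ha _ _ rfl, fracIntCLM_apply_zero hb _ _ rfl]
  simp

theorem formula_eq [CompleteSpace X] [CompleteSpace Y] {α β : ℝ} (ha : 0 < α - β) (hb : 0 < α)
    (R : Y →L[ℝ] X) {g : ℝ → Y} (hg : ∀ t : Icc (0 : ℝ) T, g t = G t) (t : Icc (0 : ℝ) T) :
    formula α β R A B η η' g t = R ((rpowSMul T 0 le_rfl η + resolvent hT (α - β) α A B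
      (rpowSMul T 1 zero_le_one η' + fracIntCLM hT α (rpowSMul T 0 le_rfl (B η))
        + fracIntCLM hT α G)) t) := by
  have hgc : ContinuousOn g (Icc 0 T) :=
    continuousOn_iff_continuous_domRestrict.2 (G.continuous.congr fun t => (hg t).symm)
  have hint : IntervalIntegrable
      (fun s => (t - s : ℝ) ^ (α - 1) • ml (α - β) α α A B (t - s) (g s)) volume 0 t :=
    intervalIntegrable_ml A B ha hb (ContinuousLinearMap.id ℝ Y) hgc t.2
  have h2 := (Real.Gamma_pos_of_pos (show 0 < α + 1 by linarith)).ne'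
  rw [fracIntCLM_rpowSMul le_rfl hb.le]
  simp only [map_add, map_smul, ContinuousMap.add_apply, ContinuousMap.smul_apply,
    rpowSMul_zero_apply, resolvent_rpowSMul A B ha hb, resolvent_fracIntCLM A B ha hb G hg]
  rw [← ContinuousLinearMap.intervalIntegral_comp_comm _ hint, formula]
  simp only [zero_add, Real.Gamma_one, Real.rpow_one, add_apply, smul_apply,
    ContinuousLinearMap.comp_apply, map_smul, one_add_one_eq_two, Real.Gamma_two, one_smul]
  -- The Γ(α+1) produced by the resolvent on t^α cancels the one from I^α of a constant.
  rw [smul_smul (1 / _), one_div, inv_mul_cancel₀ h2, one_smul]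
  abel

variable {E A₀ B₀ : X →ₗ.[ℝ] Y} {R : Y →L[ℝ] X}

/-- The correspondence is u = E y, y = R u. R commutes with fractional integration, so the integral
of y - y(0) stays in the range of R, where A₀ acts through A and the domain condition is automatic.
-/
theorem isMildSolution_iff_exists [CompleteSpace X] [CompleteSpace Y] {α β : ℝ}
    (hF : IsFactorization E A₀ B₀ R A B) (ha : 0 < α - β) (hb : 0 < α) {g : ℝ → Y}
    (hg : ∀ t : Icc (0 : ℝ) T, g t = G t) (y : ℝ → X) :
    IsMildSolution α β T E A₀ B₀ η η' g y ↔ ∃ u : C(Icc 0 T, Y),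
      (∀ t : Icc (0 : ℝ) T, y t = R (u t)) ∧ IntegralEquation hT (α - β) α A B η η' G u := by
  have key : ∀ u : C(Icc 0 T, Y), (∀ t : Icc (0 : ℝ) T, y t = R (u t)) →
      u ⟨0, left_mem_Icc.2 hT⟩ = η → ∀ t : Icc (0 : ℝ) T,
      fracInt (α - β) (fun s => y s - y 0) t =
        R (fracIntCLM hT (α - β) (u - rpowSMul T 0 le_rfl η) t) ∧
      fracInt α (fun s => app B₀ (y s) + g s) t = fracIntCLM hT α (mapCLM T B u + G) t := by
    intro u hu hu0 t
    constructor
    · rw [← mapCLM_apply, ← fracIntCLM_mapCLM ha.le]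
      refine fracInt_eq_fracIntCLM ha.le _ (fun s => ?_) t
      rw [mapCLM_apply, ContinuousMap.sub_apply, rpowSMul_zero_apply, map_sub, hu s, ← hu0]
      exact congrArg (R (u s) - ·) (hu ⟨0, left_mem_Icc.2 hT⟩)
    · refine fracInt_eq_fracIntCLM hb.le _ (fun s => ?_) t
      rw [ContinuousMap.add_apply, mapCLM_apply, ← hF.app_B, hu s, hg s]
  constructor
  · intro h
    let u : C(Icc 0 T, Y) := ⟨_, h.continuousOn.domRestrict⟩
    have hu : ∀ t : Icc (0 : ℝ) T, y t = R (u t) := fun t =>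
      (hF.inv_app _ (h.mem_domain t t.2)).symm
    -- A mild solution carries no explicit initial condition: the equation at t = 0 supplies it,
    -- integrals of positive order vanishing there.
    have hu0 : u ⟨0, left_mem_Icc.2 hT⟩ = η := by
      have h0 := h.equation 0 (left_mem_Icc.2 hT)
      rw [fracInt_of_pos ha, fracInt_of_pos hb] at h0
      simp only [intervalIntegral.integral_same, smul_zero, zero_smul, app_zero, add_zero] at h0
      exact h0
    refine ⟨u, hu, ?_⟩
    ext t
    have ht := h.equation t t.2
    rw [(key u hu hu0 t).1, (key u hu hu0 t).2, hF.app_A] at ht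
    simp only [ContinuousMap.add_apply, mapCLM_apply, rpowSMul_zero_apply, rpowSMul_one_apply]
    exact ht
  · rintro ⟨u, hu, h⟩
    have hk := key u hu (h.apply_zero ha hb)
    have happ : ∀ t : Icc (0 : ℝ) T, app E (y t) = u t := fun t => by rw [hu, hF.app_E]
    refine ⟨fun t ht => ?_, ?_, fun t ht => ?_, fun t ht => ?_⟩
    · rw [hu ⟨t, ht⟩]; exact hF.mem_E _
    · exact continuousOn_iff_continuous_domRestrict.2 (u.continuous.congr fun t => (happ t).symm)
    · rw [(hk ⟨t, ht⟩).1]; exact hF.mem_A _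
    · have ht' := congrArg (fun v => v ⟨t, ht⟩) h
      simp only [ContinuousMap.add_apply, mapCLM_apply, rpowSMul_zero_apply,
        rpowSMul_one_apply] at ht'
      rw [(hk ⟨t, ht⟩).1, (hk ⟨t, ht⟩).2, hF.app_A, happ ⟨t, ht⟩]
      exact ht'

/-- The representation formula gives the unique mild solution. -/
theorem isMildSolution_iff_eq_formula [CompleteSpace X] [CompleteSpace Y] {α β : ℝ} (hT : 0 ≤ T)
    (hF : IsFactorization E A₀ B₀ R A B) (ha : 0 < α - β) (hb : 0 < α) {g : ℝ → Y}
    (hg : ContinuousOn g (Icc 0 T)) (y : ℝ → X) :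
    IsMildSolution α β T E A₀ B₀ η η' g y ↔
      ∀ t ∈ Icc 0 T, y t = formula α β R A B η η' g t := by
  let G : C(Icc 0 T, Y) := ⟨_, hg.domRestrict⟩
  have hG : ∀ t : Icc (0 : ℝ) T, g t = G t := fun t => rfl
  rw [isMildSolution_iff_exists (hT := hT) hF ha hb hG]
  simp only [integralEquation_iff ha hb, sub_eq_iff_eq_add']
  constructor
  · rintro ⟨u, hu, h⟩ t ht
    rw [formula_eq (hT := hT) ha hb R hG ⟨t, ht⟩, ← h]
    exact hu ⟨t, ht⟩
  · intro h
    exact ⟨_, fun t => (h t t.2).trans (formula_eq ha hb R hG t), rfl⟩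

end Mild

/-! ### Primitives and derivatives on [0, T] -/

section Calculus

theorem continuousOn_of_eq {F : Type*} [TopologicalSpace F] {s : Set ℝ} {φ : ℝ → F} {f : C(s, F)}
    (h : ∀ t : s, φ t = f t) : ContinuousOn φ s :=
  continuousOn_iff_continuous_domRestrict.2 (f.continuous.congr fun t => (h t).symm)

variable {T : ℝ} {F : Type*} [NormedAddCommGroup F] [NormedSpace ℝ F] [CompleteSpace F]

theorem hasDerivWithinAt_of_eq_primitive {hT : 0 ≤ T} {φ : ℝ → F} {c : F} {f : C(Icc 0 T, F)}
    (h : ∀ t : Icc (0 : ℝ) T, φ t = c + fracIntCLM hT 1 f t) (t : Icc (0 : ℝ) T) :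
    HasDerivWithinAt φ (f t) (Icc 0 T) t := by
  have hc : Continuous (IccExtend hT f) := f.continuous.Icc_extend'
  have h1 := (hc.integral_hasStrictDerivAt 0 (t : ℝ)).hasDerivAt.hasDerivWithinAt
    (s := Icc 0 T) |>.const_add c
  rw [IccExtend_val] at h1
  refine h1.congr (fun s hs => ?_) ?_
  · rw [h ⟨s, hs⟩, fracIntCLM_one_apply]
  · rw [h t, fracIntCLM_one_apply]

theorem derivWithin_of_eq_primitive (hT : 0 < T) {φ : ℝ → F} {c : F} {f : C(Icc 0 T, F)}
    (h : ∀ t : Icc (0 : ℝ) T, φ t = c + fracIntCLM hT.le 1 f t) (t : Icc (0 : ℝ) T) :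
    derivWithin φ (Icc 0 T) t = f t :=
  (hasDerivWithinAt_of_eq_primitive h t).derivWithin (uniqueDiffOn_Icc hT t t.2)

theorem contDiffOn_one_of_eq_primitive (hT : 0 < T) {φ : ℝ → F} {c : F} {f : C(Icc 0 T, F)}
    (h : ∀ t : Icc (0 : ℝ) T, φ t = c + fracIntCLM hT.le 1 f t) :
    ContDiffOn ℝ 1 φ (Icc 0 T) :=
  (contDiffOn_one_iff_derivWithin (uniqueDiffOn_Icc hT)).2
    ⟨fun t ht => (hasDerivWithinAt_of_eq_primitive h ⟨t, ht⟩).differentiableWithinAt,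
      continuousOn_of_eq (derivWithin_of_eq_primitive hT h)⟩

theorem contDiffOn_two_of_eq_primitive (hT : 0 < T) {φ : ℝ → F} {f : C(Icc 0 T, F)}
    (h : ∀ t : Icc (0 : ℝ) T, φ t = fracIntCLM hT.le 2 f t) :
    ContDiffOn ℝ 2 φ (Icc 0 T) ∧
      ∀ t : Icc (0 : ℝ) T, iteratedDerivWithin 2 φ (Icc 0 T) t = f t := by
  have h1 : ∀ t : Icc (0 : ℝ) T, φ t = 0 + fracIntCLM hT.le 1 (fracIntCLM hT.le 1 f) t := by
    intro t
    rw [h, fracIntCLM_comp zero_le_one zero_le_one, one_add_one_eq_two, zero_add]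
  have h2 : ∀ t : Icc (0 : ℝ) T, derivWithin φ (Icc 0 T) t = 0 + fracIntCLM hT.le 1 f t := by
    intro t
    rw [derivWithin_of_eq_primitive hT h1, zero_add]
  constructor
  · rw [← one_add_one_eq_two, contDiffOn_succ_iff_derivWithin (uniqueDiffOn_Icc hT)]
    exact ⟨fun t ht => (hasDerivWithinAt_of_eq_primitive h1 ⟨t, ht⟩).differentiableWithinAt,
      by simp, contDiffOn_one_of_eq_primitive hT h2⟩
  · intro t
    rw [iteratedDerivWithin_succ, iteratedDerivWithin_one, derivWithin_of_eq_primitive hT h2]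

theorem exists_primitive_of_contDiffOn_one (hT : 0 < T) {φ : ℝ → F}
    (hφ : ContDiffOn ℝ 1 φ (Icc 0 T)) : ∃ f : C(Icc 0 T, F),
      (∀ t : Icc (0 : ℝ) T, derivWithin φ (Icc 0 T) t = f t) ∧
      ∀ t : Icc (0 : ℝ) T, φ t = φ 0 + fracIntCLM hT.le 1 f t := by
  obtain ⟨hd, hc⟩ := (contDiffOn_one_iff_derivWithin (uniqueDiffOn_Icc hT)).1 hφ
  let f : C(Icc 0 T, F) := ⟨_, hc.domRestrict⟩
  refine ⟨f, fun t => rfl, fun t => ?_⟩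
  have hfc : Continuous (IccExtend hT.le f) := f.continuous.Icc_extend'
  rw [fracIntCLM_one_apply, intervalIntegral.integral_eq_sub_of_hasDerivAt_of_le t.2.1
    (hφ.continuousOn.mono (Icc_subset_Icc_right t.2.2)) (fun s hs => ?_)
    (hfc.intervalIntegrable _ _)]
  · abel
  · have hs' : s ∈ Icc 0 T := ⟨hs.1.le, hs.2.le.trans t.2.2⟩
    rw [IccExtend_of_mem hT.le _ hs']
    exact (hd s hs').hasDerivWithinAt.hasDerivAt (Icc_mem_nhds hs.1 (hs.2.trans_le t.2.2))

theorem exists_primitive_of_contDiffOn_two (hT : 0 < T) {φ : ℝ → F}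
    (hφ : ContDiffOn ℝ 2 φ (Icc 0 T)) : ∃ f : C(Icc 0 T, F),
      (∀ t : Icc (0 : ℝ) T, iteratedDerivWithin 2 φ (Icc 0 T) t = f t) ∧
      ∀ t : Icc (0 : ℝ) T, derivWithin φ (Icc 0 T) t =
        derivWithin φ (Icc 0 T) 0 + fracIntCLM hT.le 1 f t := by
  rw [← one_add_one_eq_two, contDiffOn_succ_iff_derivWithin (uniqueDiffOn_Icc hT)] at hφ
  obtain ⟨f, hf, h⟩ := exists_primitive_of_contDiffOn_one hT hφ.2.2
  refine ⟨f, fun t => ?_, h⟩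
  rw [iteratedDerivWithin_succ, iteratedDerivWithin_one, hf]

/-- The integral of a function with values in a closed subspace lies in the subspace. -/
theorem fracIntCLM_one_mem {hT : 0 ≤ T} {S : Submodule ℝ F} (hS : IsClosed (S : Set F))
    {f : C(Icc 0 T, F)} (hf : ∀ t : Icc (0 : ℝ) T, 0 < (t : ℝ) → f t ∈ S) (t : Icc (0 : ℝ) T) :
    fracIntCLM hT 1 f t ∈ S := by
  classical
  have : CompleteSpace S := hS.completeSpace_coe
  -- f viewed as a function into the complete space S. The default 0 is never seen by the integral
  -- over (0, t], which also explains why nothing is asked of f at 0.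
  let f' : ℝ → S := fun s => if h : IccExtend hT f s ∈ S then ⟨_, h⟩ else 0
  have h : ∫ s in (0 : ℝ)..t, IccExtend hT f s = S.subtypeₗᵢ (∫ s in (0 : ℝ)..t, f' s) := by
    rw [intervalIntegral.integral_of_le t.2.1, intervalIntegral.integral_of_le t.2.1,
      -- For an isometry this exchange needs no integrability of f'.
      ← LinearIsometry.integral_comp_comm]
    refine setIntegral_congr_fun measurableSet_Ioc fun s hs => ?_
    have hs' : s ∈ Icc 0 T := ⟨hs.1.le, hs.2.trans t.2.2⟩
    have hmem : IccExtend hT f s ∈ S := by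
      rw [IccExtend_of_mem hT _ hs']
      exact hf ⟨s, hs'⟩ hs.1
    simp only [f', dif_pos hmem]
    rfl
  rw [fracIntCLM_one_apply, h]
  exact (∫ s in (0 : ℝ)..t, f' s).2

end Calculus

/-! ### Caputo derivatives of order in (0, 1] and (1, 2] -/

section Order

variable {T : ℝ} {F : Type*} [NormedAddCommGroup F] [NormedSpace ℝ F] {β α : ℝ}

theorem ceil_eq_one (h₀ : 0 < β) (h₁ : β ≤ 1) : ⌈β⌉₊ = 1 := by
  rw [Nat.ceil_eq_iff one_ne_zero]
  simpa using ⟨h₀, h₁⟩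

theorem ceil_eq_two (h₁ : 1 < α) (h₂ : α ≤ 2) : ⌈α⌉₊ = 2 := by
  rw [Nat.ceil_eq_iff two_ne_zero]
  simpa using ⟨h₁, h₂⟩

theorem caputoPrimitive_of_le_one (h₀ : 0 < β) (h₁ : β ≤ 1) (f : ℝ → F) :
    caputoPrimitive T β f = fracInt (1 - β) fun s => f s - f 0 := by
  simp [caputoPrimitive, ceil_eq_one h₀ h₁, taylorZero]

theorem caputo_of_le_one (h₀ : 0 < β) (h₁ : β ≤ 1) (f : ℝ → F) (t : ℝ) :
    caputo T β f t = derivWithin (caputoPrimitive T β f) (Icc 0 T) t := by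
  rw [caputo, ceil_eq_one h₀ h₁, iteratedDerivWithin_one]

theorem caputoDifferentiable_of_le_one (h₀ : 0 < β) (h₁ : β ≤ 1) (f : ℝ → F) :
    CaputoDifferentiable T β f ↔
      ContinuousOn f (Icc 0 T) ∧ ContDiffOn ℝ 1 (caputoPrimitive T β f) (Icc 0 T) := by
  rw [CaputoDifferentiable, ceil_eq_one h₀ h₁]
  simp [contDiffOn_zero]

theorem caputoClassical_of_le_one (h₀ : 0 < β) (h₁ : β ≤ 1) (f : ℝ → F) (t : ℝ) :
    caputoClassical T β f t = fracInt (1 - β) (derivWithin f (Icc 0 T)) t := by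
  rw [caputoClassical, ceil_eq_one h₀ h₁, Nat.cast_one, iteratedDerivWithin_one]

theorem caputoPrimitive_of_le_two (h₁ : 1 < α) (h₂ : α ≤ 2) (f : ℝ → F) :
    caputoPrimitive T α f =
      fracInt (2 - α) fun s => f s - (f 0 + s • derivWithin f (Icc 0 T) 0) := by
  simp [caputoPrimitive, ceil_eq_two h₁ h₂, taylorZero, Finset.sum_range_succ,
    iteratedDerivWithin_one]

theorem caputo_of_le_two (h₁ : 1 < α) (h₂ : α ≤ 2) (f : ℝ → F) (t : ℝ) :
    caputo T α f t = iteratedDerivWithin 2 (caputoPrimitive T α f) (Icc 0 T) t := by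
  rw [caputo, ceil_eq_two h₁ h₂]

theorem caputoDifferentiable_of_le_two (h₁ : 1 < α) (h₂ : α ≤ 2) (f : ℝ → F) :
    CaputoDifferentiable T α f ↔
      ContDiffOn ℝ 1 f (Icc 0 T) ∧ ContDiffOn ℝ 2 (caputoPrimitive T α f) (Icc 0 T) := by
  rw [CaputoDifferentiable, ceil_eq_two h₁ h₂]
  simp

theorem caputoClassical_of_le_two (h₁ : 1 < α) (h₂ : α ≤ 2) (f : ℝ → F) (t : ℝ) :
    caputoClassical T α f t = fracInt (2 - α) (iteratedDerivWithin 2 f (Icc 0 T)) t := by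
  rw [caputoClassical, ceil_eq_two h₁ h₂, Nat.cast_ofNat]

end Order

/-! ### Graphs of partially defined operators -/

section Graph

variable {X Y : Type*} [NormedAddCommGroup X] [NormedSpace ℝ X]
  [NormedAddCommGroup Y] [NormedSpace ℝ Y]

theorem app_eq_of_mem_graph {S : X →ₗ.[ℝ] Y} {v : X} {z : Y} (h : (v, z) ∈ S.graph) :
    app S v = z := by
  obtain ⟨w, hw, hz⟩ := (LinearPMap.mem_graph_iff S).1 h
  dsimp only at hw hz
  subst hw
  rw [app_of_mem S w.2, ← hz]

theorem mem_graph_app {S : X →ₗ.[ℝ] Y} {v : X} (h : v ∈ S.domain) : (v, app S v) ∈ S.graph := by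
  rw [app_of_mem S h]
  exact S.mem_graph ⟨v, h⟩

end Graph

/-! ### Equivalence of Caputo and mild solutions -/

section Caputo

variable {X Y : Type*} [NormedAddCommGroup X] [NormedSpace ℝ X] [CompleteSpace X]
  [NormedAddCommGroup Y] [NormedSpace ℝ Y] [CompleteSpace Y]
  {T α β : ℝ} {A B : Y →L[ℝ] Y} {η η' : Y} {G u : C(Icc 0 T, Y)}
  {E A₀ B₀ : X →ₗ.[ℝ] Y} {R : Y →L[ℝ] X}

/-- The Caputo primitive of order at most one of `R u`. -/
theorem caputoPrimitive_eq_of_le_one (hT : 0 ≤ T) (hβ₀ : 0 < β) (hβ₁ : β ≤ 1) {F : Type*}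
    [NormedAddCommGroup F] [NormedSpace ℝ F] {y : ℝ → F} {y₀ : F} {u : C(Icc 0 T, F)}
    (hy : ∀ t : Icc (0 : ℝ) T, y t = u t) (hu0 : u ⟨0, left_mem_Icc.2 hT⟩ = y₀)
    (t : Icc (0 : ℝ) T) :
    caputoPrimitive T β y t = fracIntCLM hT (1 - β) (u - rpowSMul T 0 le_rfl y₀) t := by
  rw [caputoPrimitive_of_le_one hβ₀ hβ₁]
  refine fracInt_eq_fracIntCLM (by linarith) _ (fun s => ?_) t
  rw [ContinuousMap.sub_apply, rpowSMul_zero_apply, ← hu0, ← hy s]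
  exact congrArg (y s - ·) (hy ⟨0, left_mem_Icc.2 hT⟩)

/-- The Caputo primitive of order between one and two of `η + I^1 v` with `v 0 = η'`. -/
theorem caputoPrimitive_eq_of_le_two (hT : 0 < T) (hα₁ : 1 < α) (hα₂ : α ≤ 2) {φ : ℝ → Y}
    {v : C(Icc 0 T, Y)} (hφ : ∀ t : Icc (0 : ℝ) T, φ t = η + fracIntCLM hT.le 1 v t)
    (hv : v ⟨0, left_mem_Icc.2 hT.le⟩ = η') (t : Icc (0 : ℝ) T) :
    caputoPrimitive T α φ t =
      fracIntCLM hT.le (2 - α) (fracIntCLM hT.le 1 (v - rpowSMul T 0 le_rfl η')) t := by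
  rw [caputoPrimitive_of_le_two hα₁ hα₂]
  refine fracInt_eq_fracIntCLM (by linarith) _ (fun s => ?_) t
  have h0 := hφ ⟨0, left_mem_Icc.2 hT.le⟩
  rw [fracIntCLM_apply_zero one_pos _ _ rfl, add_zero] at h0
  have h1 := derivWithin_of_eq_primitive hT hφ ⟨0, left_mem_Icc.2 hT.le⟩
  dsimp only at h0 h1
  rw [h0, h1, hv, hφ s, map_sub, fracIntCLM_one_rpowSMul_zero, ContinuousMap.sub_apply,
    rpowSMul_one_apply]
  abel

/-- The two Caputo derivatives are recovered from their primitives by integrating once; closedness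
of A₀ lets the integral pass through A₀. The result is the integral equation differentiated to order
α - 1, and I^(α-1) restores it. -/
theorem exists_integralEquation_of_isCaputoSolution (hT : 0 < T) (hα₁ : 1 < α) (hα₂ : α ≤ 2)
    (hβ₀ : 0 < β) (hβ₁ : β ≤ 1) (hF : IsFactorization E A₀ B₀ R A B) (hA₀ : A₀.IsClosed)
    {g : ℝ → Y} (hg : ∀ t : Icc (0 : ℝ) T, g t = G t) {y : ℝ → X}
    (h : IsCaputoSolution α β T E A₀ B₀ η η' g y) :
    ∃ u : C(Icc 0 T, Y), (∀ t : Icc (0 : ℝ) T, y t = R (u t)) ∧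
      IntegralEquation hT.le (α - β) α A B η η' G u := by
  obtain ⟨hd1, hd2⟩ := (caputoDifferentiable_of_le_two hα₁ hα₂ _).1 h.differentiable_E
  obtain ⟨-, hd3⟩ := (caputoDifferentiable_of_le_one hβ₀ hβ₁ _).1 h.differentiable
  let o : Icc (0 : ℝ) T := ⟨0, left_mem_Icc.2 hT.le⟩
  let u : C(Icc 0 T, Y) := ⟨_, hd1.continuousOn.domRestrict⟩
  have hu : ∀ t : Icc (0 : ℝ) T, app E (y t) = u t := fun t => rfl
  have hyu : ∀ t : Icc (0 : ℝ) T, y t = R (u t) := fun t =>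
    (hF.inv_app _ (h.mem_domain t t.2)).symm
  have hu0 : u o = η := h.initial_value
  obtain ⟨v, hv, hφ⟩ := exists_primitive_of_contDiffOn_one hT hd1
  have hv0 : v o = η' := (hv o).symm.trans h.initial_deriv
  simp only [h.initial_value] at hφ
  have huv : u - rpowSMul T 0 le_rfl η = fracIntCLM hT.le 1 v := by
    ext t
    rw [ContinuousMap.sub_apply, rpowSMul_zero_apply, ← hu t, hφ t, add_sub_cancel_left]
  set ψ := fracIntCLM hT.le (2 - α) (v - rpowSMul T 0 le_rfl η') with hψ
  -- For α = 2 the operator I^(2-α) is the identity, and the vanishing comes from v(0) = η' instead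
  -- of from a positive order.
  have hψ0 : ψ o = 0 := by
    rcases hα₂.eq_or_lt with h2 | h2
    · rw [hψ, h2, sub_self, fracIntCLM_zero, ContinuousMap.sub_apply, rpowSMul_zero_apply, hv0,
        sub_self]
    · exact fracIntCLM_apply_zero (sub_pos.2 h2) _ _ rfl
  have hP : ∀ t : Icc (0 : ℝ) T, caputoPrimitive T α (fun t => app E (y t)) t =
      0 + fracIntCLM hT.le 1 ψ t := by
    intro t
    rw [caputoPrimitive_eq_of_le_two hT hα₁ hα₂ hφ hv0, zero_add,
      fracIntCLM_comm (by linarith) zero_le_one]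
  obtain ⟨w, hw, hw'⟩ := exists_primitive_of_contDiffOn_two hT hd2
  have hψw : ψ = fracIntCLM hT.le 1 w := by
    ext t
    have := hw' t
    rw [derivWithin_of_eq_primitive hT hP t] at this
    have h0 := derivWithin_of_eq_primitive hT hP o
    rw [show ((o : Icc (0 : ℝ) T) : ℝ) = 0 from rfl, hψ0] at h0
    rw [this, h0, zero_add]
  set q := fracIntCLM hT.le (1 - β) (u - rpowSMul T 0 le_rfl η) with hq
  have hp : ∀ t : Icc (0 : ℝ) T, caputoPrimitive T β y t = R (q t) := by
    intro t
    rw [caputoPrimitive_eq_of_le_one hT.le hβ₀ hβ₁ (u := mapCLM T R u) (y₀ := R η) hyu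
      (congrArg R hu0), ← mapCLM_rpowSMul, ← map_sub, fracIntCLM_mapCLM (by linarith)]
    rfl
  have hq0 : q o = 0 := by
    rw [hq, huv, fracIntCLM_comp (by linarith) zero_le_one]
    exact fracIntCLM_apply_zero (by linarith) _ _ rfl
  obtain ⟨k, hk, hk'⟩ := exists_primitive_of_contDiffOn_one hT hd3
  have hp0 : caputoPrimitive T β y 0 = 0 := by rw [hp o, hq0, map_zero]
  set r := w - (mapCLM T B u + G) with hr
  -- The equation says (k(t), r(t)) is in the graph for t > 0, k being D^β y. The graph is a closed
  -- subspace of X × Y, so it contains the integral of this pair, whose first component is R q(t).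
  have hgraph : ∀ t : Icc (0 : ℝ) T, (R (q t), fracIntCLM hT.le 1 r t) ∈ A₀.graph := by
    intro t
    let f : C(Icc 0 T, X × Y) := k.prodMk r
    have hf : ∀ t : Icc (0 : ℝ) T, 0 < (t : ℝ) → f t ∈ A₀.graph := by
      intro t ht
      have hmem := h.deriv_mem t ⟨ht, t.2.2⟩
      have heq := h.equation t ⟨ht, t.2.2⟩
      rw [caputo_of_le_one hβ₀ hβ₁, hk] at hmem heq
      rw [caputo_of_le_two hα₁ hα₂, hw, hyu t, hF.app_B, hg] at heq
      have hrt : r t = app A₀ (k t) := by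
        rw [hr, ContinuousMap.sub_apply, ContinuousMap.add_apply, mapCLM_apply, ← heq]
        abel
      change (k t, r t) ∈ A₀.graph
      rw [hrt]
      exact mem_graph_app hmem
    have hfst : mapCLM T (ContinuousLinearMap.fst ℝ X Y) f = k := rfl
    have hsnd : mapCLM T (ContinuousLinearMap.snd ℝ X Y) f = r := rfl
    have hRq : R (q t) = fracIntCLM hT.le 1 k t := by rw [← hp t, hk' t, hp0, zero_add]
    rw [hRq, ← hfst, ← hsnd, fracIntCLM_mapCLM zero_le_one, fracIntCLM_mapCLM zero_le_one]
    exact fracIntCLM_one_mem hA₀ hf t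
  have hAq : ψ = mapCLM T A q + fracIntCLM hT.le 1 (mapCLM T B u + G) := by
    have : mapCLM T A q = fracIntCLM hT.le 1 r := by
      ext t
      rw [mapCLM_apply, ← hF.app_A, app_eq_of_mem_graph (hgraph t)]
    rw [this, hr, hψw, map_sub, sub_add_cancel]
  refine ⟨u, hyu, ?_⟩
  -- The orders 2-α, 1-β and 1 become 1, α-β and α.
  have hfin := congrArg (fracIntCLM hT.le (α - 1)) hAq
  rw [hψ, hq, map_add, fracIntCLM_mapCLM (by linarith), fracIntCLM_comp (by linarith) (by linarith),
    fracIntCLM_comp (by linarith) (by linarith), fracIntCLM_comp (by linarith) zero_le_one,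
    show α - 1 + (2 - α) = 1 by ring, show α - 1 + (1 - β) = α - β by ring, sub_add_cancel,
    map_sub, fracIntCLM_one_rpowSMul_zero, ← huv] at hfin
  rw [IntegralEquation, add_assoc, ← hfin]
  abel

/-- Differentiability comes from the resolvent: u - η is I^1 of a continuous v. Then D^β y = R
I^(1-β) v lies in the range of R, so this direction needs no closedness of A₀. -/
theorem isCaputoSolution_of_integralEquation (hT : 0 < T) (hα₁ : 1 < α) (hα₂ : α ≤ 2)
    (hβ₀ : 0 < β) (hβ₁ : β ≤ 1) (hF : IsFactorization E A₀ B₀ R A B)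
    {g : ℝ → Y} (hg : ∀ t : Icc (0 : ℝ) T, g t = G t) {y : ℝ → X}
    (hy : ∀ t : Icc (0 : ℝ) T, y t = R (u t))
    (h : IntegralEquation hT.le (α - β) α A B η η' G u) :
    IsCaputoSolution α β T E A₀ B₀ η η' g y := by
  have ha : 0 < α - β := by linarith
  have hb : 0 < α := by linarith
  have hα : 0 ≤ 2 - α := by linarith
  have hβ : 0 ≤ 1 - β := by linarith
  let o : Icc (0 : ℝ) T := ⟨0, left_mem_Icc.2 hT.le⟩
  have hu0 : u o = η := h.apply_zero ha hb
  have hw := (integralEquation_iff ha hb).1 h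
  -- The Volterra data with one integration removed, possible since α > 1; v is then the derivative
  -- of u.
  set f := rpowSMul T 0 le_rfl η' +
    fracIntCLM hT.le (α - 1) (rpowSMul T 0 le_rfl (B η) + G) with hf
  set v := resolvent hT.le (α - β) α A B f with hv
  have huv : u - rpowSMul T 0 le_rfl η = fracIntCLM hT.le 1 v := by
    rw [hw, hv, fracIntCLM_resolvent A B ha hb zero_le_one, hf, map_add (fracIntCLM hT.le 1),
      fracIntCLM_one_rpowSMul_zero, fracIntCLM_comp zero_le_one (by linarith),
      add_sub_cancel, map_add (fracIntCLM hT.le α), add_assoc]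
  have hv0 : v o = η' := by
    have hv' := (eq_add_volterra_iff A B ha hb f v).2 hv
    rw [hv', hf, volterra]
    simp only [ContinuousMap.add_apply, add_apply, ContinuousLinearMap.comp_apply, mapCLM_apply,
      rpowSMul_zero_apply]
    rw [fracIntCLM_apply_zero ha _ _ rfl, fracIntCLM_apply_zero hb _ _ rfl,
      fracIntCLM_apply_zero (sub_pos.2 hα₁) _ _ rfl]
    simp
  have hEy : ∀ t : Icc (0 : ℝ) T, app E (y t) = u t := fun t => by rw [hy, hF.app_E]
  have hφ : ∀ t : Icc (0 : ℝ) T, app E (y t) = η + fracIntCLM hT.le 1 v t := by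
    intro t
    rw [hEy, ← huv, ContinuousMap.sub_apply, rpowSMul_zero_apply, add_sub_cancel]
  set z := fracIntCLM hT.le (1 - β) v with hz
  have hP : ∀ t : Icc (0 : ℝ) T, caputoPrimitive T α (fun t => app E (y t)) t =
      fracIntCLM hT.le 2 (mapCLM T A z + (mapCLM T B u + G)) t := by
    intro t
    rw [caputoPrimitive_eq_of_le_two hT hα₁ hα₂ hφ hv0]
    have h1 : fracIntCLM hT.le 1 (v - rpowSMul T 0 le_rfl η') =
        mapCLM T A (fracIntCLM hT.le (α - β) (fracIntCLM hT.le 1 v)) +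
          fracIntCLM hT.le α (mapCLM T B u + G) := by
      rw [map_sub, fracIntCLM_one_rpowSMul_zero, ← huv, sub_sub, sub_eq_iff_eq_add']
      exact h.trans (by abel)
    rw [h1, map_add (fracIntCLM hT.le (2 - α)), fracIntCLM_mapCLM hα,
      fracIntCLM_comp ha.le zero_le_one, fracIntCLM_comp hα (by linarith), fracIntCLM_comp hα hb.le,
      map_add (fracIntCLM hT.le 2), fracIntCLM_mapCLM zero_le_two, hz,
      fracIntCLM_comp zero_le_two hβ, sub_add_cancel,
      show 2 - α + (α - β + 1) = 2 + (1 - β) by ring]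
  have hp : ∀ t : Icc (0 : ℝ) T, caputoPrimitive T β y t =
      0 + fracIntCLM hT.le 1 (mapCLM T R z) t := by
    intro t
    rw [caputoPrimitive_eq_of_le_one hT.le hβ₀ hβ₁ (u := mapCLM T R u) (y₀ := R η) hy
      (congrArg R hu0), ← mapCLM_rpowSMul, ← map_sub, huv, fracIntCLM_mapCLM hβ,
      fracIntCLM_mapCLM zero_le_one, hz, fracIntCLM_comm hβ zero_le_one, zero_add]
  obtain ⟨hP₁, hP₂⟩ := contDiffOn_two_of_eq_primitive hT hP
  have hp' : ∀ t : Icc (0 : ℝ) T, caputo T β y t = R (z t) := fun t => by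
    rw [caputo_of_le_one hβ₀ hβ₁, derivWithin_of_eq_primitive hT hp, mapCLM_apply]
  refine ⟨fun t ht => ?_, ?_, ?_, ?_, ?_, fun t ht => ?_, fun t ht => ?_⟩
  · rw [hy ⟨t, ht⟩]
    exact hF.mem_E _
  · exact (caputoDifferentiable_of_le_two hα₁ hα₂ _).2
      ⟨contDiffOn_one_of_eq_primitive hT hφ, hP₁⟩
  · exact (caputoDifferentiable_of_le_one hβ₀ hβ₁ _).2
      ⟨continuousOn_of_eq (f := mapCLM T R u) hy, contDiffOn_one_of_eq_primitive hT hp⟩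
  · exact (hEy o).trans hu0
  · exact (derivWithin_of_eq_primitive hT hφ o).trans hv0
  · rw [hp' ⟨t, Ioc_subset_Icc_self ht⟩]
    exact hF.mem_A _
  · have ht' := Ioc_subset_Icc_self ht
    rw [hp' ⟨t, ht'⟩, caputo_of_le_two hα₁ hα₂, hP₂ ⟨t, ht'⟩, hF.app_A, hy ⟨t, ht'⟩, hF.app_B,
      hg ⟨t, ht'⟩]
    simp only [ContinuousMap.add_apply, mapCLM_apply]
    abel

/-- Caputo solutions and mild solutions coincide. -/
theorem isCaputoSolution_iff_isMildSolution (hT : 0 < T) (hα₁ : 1 < α) (hα₂ : α ≤ 2)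
    (hβ₀ : 0 < β) (hβ₁ : β ≤ 1) (hF : IsFactorization E A₀ B₀ R A B) (hA₀ : A₀.IsClosed)
    {g : ℝ → Y} (hg : ContinuousOn g (Icc 0 T)) (y : ℝ → X) :
    IsCaputoSolution α β T E A₀ B₀ η η' g y ↔ IsMildSolution α β T E A₀ B₀ η η' g y := by
  have hG : ∀ t : Icc (0 : ℝ) T, g t = (⟨_, hg.domRestrict⟩ : C(Icc 0 T, Y)) t := fun t => rfl
  rw [isMildSolution_iff_exists (hT := hT.le) hF (by linarith) (by linarith) hG]
  exact ⟨exists_integralEquation_of_isCaputoSolution hT hα₁ hα₂ hβ₀ hβ₁ hF hA₀ hG,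
    fun ⟨_, hu, h⟩ => isCaputoSolution_of_integralEquation hT hα₁ hα₂ hβ₀ hβ₁ hF hG hu h⟩

/-- φ - φ(0) is I^1 of φ', and I^(1-β) commutes with I^1; differentiating removes the I^1. The
order-two case is the same with I^2 and φ''. -/
theorem caputo_eq_caputoClassical_of_le_one {F : Type*} [NormedAddCommGroup F] [NormedSpace ℝ F]
    [CompleteSpace F] (hT : 0 < T) (hβ₀ : 0 < β) (hβ₁ : β ≤ 1) {φ : ℝ → F}
    (hφ : ContDiffOn ℝ 1 φ (Icc 0 T)) : CaputoDifferentiable T β φ ∧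
      ∀ t ∈ Icc 0 T, caputo T β φ t = caputoClassical T β φ t := by
  obtain ⟨f, hf, hf'⟩ := exists_primitive_of_contDiffOn_one hT hφ
  have hβ : 0 ≤ 1 - β := by linarith
  have hp : ∀ t : Icc (0 : ℝ) T, caputoPrimitive T β φ t =
      0 + fracIntCLM hT.le 1 (fracIntCLM hT.le (1 - β) f) t := by
    intro t
    rw [caputoPrimitive_of_le_one hβ₀ hβ₁, fracIntCLM_comm zero_le_one hβ, zero_add]
    exact fracInt_eq_fracIntCLM hβ _ (fun s => by rw [hf', add_sub_cancel_left]) t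
  refine ⟨(caputoDifferentiable_of_le_one hβ₀ hβ₁ φ).2
    ⟨hφ.continuousOn, contDiffOn_one_of_eq_primitive hT hp⟩, fun t ht => ?_⟩
  rw [caputo_of_le_one hβ₀ hβ₁, caputoClassical_of_le_one hβ₀ hβ₁,
    derivWithin_of_eq_primitive hT hp ⟨t, ht⟩, ← fracInt_eq_fracIntCLM hβ f hf]

theorem caputo_eq_caputoClassical_of_le_two {F : Type*} [NormedAddCommGroup F] [NormedSpace ℝ F]
    [CompleteSpace F] (hT : 0 < T) (hα₁ : 1 < α) (hα₂ : α ≤ 2) {φ : ℝ → F}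
    (hφ : ContDiffOn ℝ 2 φ (Icc 0 T)) : CaputoDifferentiable T α φ ∧
      ∀ t ∈ Icc 0 T, caputo T α φ t = caputoClassical T α φ t := by
  have hφ1 := hφ.of_le one_le_two
  obtain ⟨f, hf, hf'⟩ := exists_primitive_of_contDiffOn_one hT hφ1
  obtain ⟨h, hh, hh'⟩ := exists_primitive_of_contDiffOn_two hT hφ
  have hα : 0 ≤ 2 - α := by linarith
  have hfh : f = rpowSMul T 0 le_rfl (derivWithin φ (Icc 0 T) 0) + fracIntCLM hT.le 1 h := by
    ext t
    rw [← hf, hh', ContinuousMap.add_apply, rpowSMul_zero_apply]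
  have hP : ∀ t : Icc (0 : ℝ) T, caputoPrimitive T α φ t =
      fracIntCLM hT.le 2 (fracIntCLM hT.le (2 - α) h) t := by
    intro t
    rw [caputoPrimitive_eq_of_le_two hT hα₁ hα₂ hf' (hf _).symm, hfh, add_sub_cancel_left,
      fracIntCLM_comp zero_le_one zero_le_one, one_add_one_eq_two, fracIntCLM_comm hα zero_le_two]
  obtain ⟨h₁, h₂⟩ := contDiffOn_two_of_eq_primitive hT hP
  refine ⟨(caputoDifferentiable_of_le_two hα₁ hα₂ φ).2 ⟨hφ1, h₁⟩, fun t ht => ?_⟩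
  rw [caputo_of_le_two hα₁ hα₂, caputoClassical_of_le_two hα₁ hα₂, h₂ ⟨t, ht⟩,
    ← fracInt_eq_fracIntCLM hα h hh]

theorem IsC2Solution.isCaputoSolution (hT : 0 < T) (hα₁ : 1 < α) (hα₂ : α ≤ 2)
    (hβ₀ : 0 < β) (hβ₁ : β ≤ 1) {g : ℝ → Y} {y : ℝ → X}
    (h : IsC2Solution α β T E A₀ B₀ η η' g y) : IsCaputoSolution α β T E A₀ B₀ η η' g y := by
  obtain ⟨h₁, h₂⟩ := caputo_eq_caputoClassical_of_le_one hT hβ₀ hβ₁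
    (h.contDiffOn.of_le one_le_two)
  obtain ⟨h₃, h₄⟩ := caputo_eq_caputoClassical_of_le_two hT hα₁ hα₂ h.contDiffOn_E
  refine ⟨h.mem_domain, h₃, h₁, h.initial_value, h.initial_deriv, fun t ht => ?_, fun t ht => ?_⟩
  · rw [h₂ t (Ioc_subset_Icc_self ht)]
    exact h.deriv_mem t ht
  · rw [h₂ t (Ioc_subset_Icc_self ht), h₄ t (Ioc_subset_Icc_self ht)]
    exact h.equation t ht

end Caputo

/-! ### Boundedness of A and B -/

section Bounded

variable {X Y : Type*} [NormedAddCommGroup X] [NormedSpace ℝ X]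
  [NormedAddCommGroup Y] [NormedSpace ℝ Y]

/-- Closed graph theorem: the graph is the preimage of that of S under the continuous map (z, w) ↦
(E⁻¹z, w). -/
theorem continuous_compInv_of_isClosed [CompleteSpace Y] {S E : X →ₗ.[ℝ] Y}
    (hS : S.IsClosed) (hE : Function.Bijective E) (h : E.domain ≤ S.domain)
    (hR : Continuous (invE E hE)) : Continuous (compInv S E hE h) := by
  refine LinearMap.continuous_of_isClosed_graph _ ?_
  have hpre : ((compInv S E hE h).graph : Set (Y × Y)) =
      (fun p : Y × Y => (invE E hE p.1, p.2)) ⁻¹' (S.graph : Set (X × Y)) := by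
    ext ⟨z, w⟩
    have hz : (invE E hE z, compInv S E hE h z) ∈ S.graph :=
      S.mem_graph (Submodule.inclusion h ((domEquiv E hE).symm z))
    simp only [SetLike.mem_coe, LinearMap.mem_graph_iff, mem_preimage]
    constructor
    · rintro rfl
      exact hz
    · exact fun hw => S.mem_graph_snd_inj hw hz rfl
  rw [hpre]
  exact IsClosed.preimage ((hR.comp continuous_fst).prodMk continuous_snd) hS

theorem continuous_compInv_of_bound {S E : X →ₗ.[ℝ] Y}
    (hS : ∃ C : ℝ, ∀ v : S.domain, ‖S v‖ ≤ C * ‖(v : X)‖) (hE : Function.Bijective E)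
    (h : E.domain ≤ S.domain) (hR : Continuous (invE E hE)) : Continuous (compInv S E hE h) := by
  obtain ⟨C, hC⟩ := hS
  let R : Y →L[ℝ] X := ⟨invE E hE, hR⟩
  -- |C| is used because C is not assumed nonnegative.
  refine AddMonoidHomClass.continuous_of_bound (compInv S E hE h) (|C| * ‖R‖) fun z => ?_
  calc ‖compInv S E hE h z‖
      ≤ C * ‖invE E hE z‖ := hC (Submodule.inclusion h ((domEquiv E hE).symm z))
    _ ≤ |C| * (‖R‖ * ‖z‖) :=
        mul_le_mul (le_abs_self C) (R.le_opNorm z) (norm_nonneg _) (abs_nonneg C)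
    _ = |C| * ‖R‖ * ‖z‖ := (mul_assoc _ _ _).symm

end Bounded

/-! ### The two forms of the representation formula -/

section Series

variable {X Y : Type*} [NormedAddCommGroup X] [NormedSpace ℝ X] [CompleteSpace X]
  [NormedAddCommGroup Y] [NormedSpace ℝ Y] [CompleteSpace Y]

theorem formula_eq_seriesFormula {α β : ℝ} (ha : 0 < α - β) (hα : 1 ≤ α) (R : Y →L[ℝ] X)
    (A B : Y →L[ℝ] Y) (η η' : Y) (g : ℝ → Y) {t : ℝ} (ht : 0 ≤ t) :
    formula α β R A B η η' g t = seriesFormula α β R A B η η' g t := by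
  have hb : 0 < α := by linarith
  have h1 := rpow_smul_ml_eq_tsum A B ht hb.le ha hb (show 0 < α + 1 by linarith) R B
  have h2 := rpow_smul_ml_eq_tsum A B ht zero_le_one ha hb two_pos R (ContinuousLinearMap.id ℝ Y)
  -- With α - 1 ≥ 0 the powers of t - s may be multiplied even at s = t.
  have h3 := fun s : ℝ => fun hs : s ≤ t => rpow_smul_ml_eq_tsum A B (sub_nonneg.2 hs)
    (sub_nonneg.2 hα) ha hb hb R (ContinuousLinearMap.id ℝ Y)
  simp only [ContinuousLinearMap.comp_id, Real.rpow_one, ← add_assoc] at h1 h2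
  simp only [ContinuousLinearMap.comp_id, ← add_sub_assoc] at h3
  rw [formula, seriesFormula, h1, h2]
  congr 1
  refine intervalIntegral.integral_congr fun s hs => ?_
  rw [uIcc_of_le ht] at hs
  simp only [h3 s hs.2]

end Series

end SobolevFrac

/-! ### The main theorem -/

theorem mainTheorem2 {X Y : Type*}
    [NormedAddCommGroup X] [NormedSpace ℝ X] [CompleteSpace X]
    [NormedAddCommGroup Y] [NormedSpace ℝ Y] [CompleteSpace Y]
    (α β T : ℝ) (hα₁ : 1 < α) (hα₂ : α ≤ 2) (hβ₀ : 0 < β) (hβ₁ : β ≤ 1) (hT : 0 < T)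
    (E A₀ B₀ : X →ₗ.[ℝ] Y)
    (hA₀ : A₀.IsClosed)
    (hB₀ : ∃ C : ℝ, ∀ v : B₀.domain, ‖B₀ v‖ ≤ C * ‖(v : X)‖)
    (hEA : E.domain ≤ A₀.domain) (hEB : E.domain ≤ B₀.domain)
    (hE : Function.Bijective E)
    (hcomp : IsCompactOperator (SobolevFrac.invE E hE))
    (η η' : Y) (g : ℝ → Y) (hg : ContinuousOn g (Set.Icc 0 T)) :
    ∃ (hR : Continuous (SobolevFrac.invE E hE))
      (hA : Continuous (SobolevFrac.compInv A₀ E hE hEA))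
      (hB : Continuous (SobolevFrac.compInv B₀ E hE hEB)),
      let R : Y →L[ℝ] X := ⟨SobolevFrac.invE E hE, hR⟩
      let A : Y →L[ℝ] Y := ⟨SobolevFrac.compInv A₀ E hE hEA, hA⟩
      let B : Y →L[ℝ] Y := ⟨SobolevFrac.compInv B₀ E hE hEB, hB⟩
      -- the series converge absolutely in operator norm and the integral in the formula exists
      (∀ c : ℝ, 0 < c → ∀ t : ℝ, 0 ≤ t →
        Summable (fun p : ℕ × ℕ => ‖SobolevFrac.mlTerm (α - β) α c A B t p.1 p.2‖)) ∧
      (∀ t ∈ Set.Icc 0 T, IntervalIntegrable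
        (fun s => ((t - s) ^ (α - 1) • (R ∘L SobolevFrac.ml (α - β) α α A B (t - s))) (g s))
        MeasureTheory.volume 0 t) ∧
      (∀ t ∈ Set.Icc 0 T, SobolevFrac.formula α β R A B η η' g t
        = SobolevFrac.seriesFormula α β R A B η η' g t) ∧
      -- the formula gives the mild solution, and it is the only one
      (∀ y : ℝ → X, SobolevFrac.IsMildSolution α β T E A₀ B₀ η η' g y ↔
        ∀ t ∈ Set.Icc 0 T, y t = SobolevFrac.formula α β R A B η η' g t) ∧
      -- it satisfies the Cauchy problem with Caputo derivatives, and is the only such function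
      (∀ y : ℝ → X, SobolevFrac.IsCaputoSolution α β T E A₀ B₀ η η' g y ↔
        ∀ t ∈ Set.Icc 0 T, y t = SobolevFrac.formula α β R A B η η' g t) ∧
      -- in particular every solution of class `C²` is represented by it
      (∀ y : ℝ → X, SobolevFrac.IsC2Solution α β T E A₀ B₀ η η' g y →
        ∀ t ∈ Set.Icc 0 T, y t = SobolevFrac.formula α β R A B η η' g t) := by
  -- Compactness of E⁻¹ enters only through the boundedness it implies.
  have hR : Continuous (SobolevFrac.invE E hE) := hcomp.continuous
  have hA := SobolevFrac.continuous_compInv_of_isClosed hA₀ hE hEA hR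
  have hB := SobolevFrac.continuous_compInv_of_bound hB₀ hE hEB hR
  refine ⟨hR, hA, hB, ?_⟩
  intro R A B
  have hF : SobolevFrac.IsFactorization E A₀ B₀ R A B :=
    SobolevFrac.isFactorization_compInv hE hEA hEB (fun _ => rfl) (fun _ => rfl) (fun _ => rfl)
  have ha : 0 < α - β := by linarith
  have hb : 0 < α := by linarith
  have hmild := SobolevFrac.isMildSolution_iff_eq_formula (η := η) (η' := η') hT.le hF ha hb hg
  have hcaputo := fun y => (SobolevFrac.isCaputoSolution_iff_isMildSolution (η := η) (η' := η')
    hT hα₁ hα₂ hβ₀ hβ₁ hF hA₀ hg y).trans (hmild y)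
  exact ⟨fun c hc t ht => SobolevFrac.summable_norm_mlTerm A B ha hb hc ht,
    fun t ht => SobolevFrac.intervalIntegrable_ml A B ha hb R hg ht,
    fun t ht => SobolevFrac.formula_eq_seriesFormula ha hα₁.le R A B η η' g ht.1,
    hmild, hcaputo,
    fun y hy => (hcaputo y).1 (hy.isCaputoSolution hT hα₁ hα₂ hβ₀ hβ₁)⟩
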